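/- Let $R$ be a regular local ring with maximal ideal $\mathfrak m$, residue field $\mathbb K=R/\mathfrak m$ and $\mathfrak m$-adic completion $\widehat R$, and let $(x_1,\dots,x_n)$ be a regular system of parameters of $R$. Let $f\in R$ and let $f=\sum_{\alpha\in\mathbb Z_{\ge 0}^n}a_\alpha \underline x^\alpha$ be a finite expansion with coefficients $a_\alpha\in R^\times\cup\{0\}$ (the notions below do not depend on its choice). The Newton polyhedron of $f$ is the convex hull $\Delta(f)\subset\mathbb R^n$ of $\{\alpha : a_\alpha\ne 0\}+\mathbb R_{\ge 0}^n$. Its faces are the sets $\Delta(f)^\xi=\{p\in\Delta(f):\langle\xi,p\rangle=\min_{q\in\Delta(f)}\langle\xi,q\rangle\}$ with $\xi\in\mathbb R_{\ge 0}^n$; an edge is a face of dimension $1$, and a loose edge is a compact edge that is not contained in any compact face of dimension $\ge 2$. For a compact face $A$ put $f|_A=\sum_{\alpha\in A}\overline{a_\alpha}\,\underline X^\alpha\in\mathbb K[X_1,\dots,X_n]$, where $\overline{a_\alpha}$ is the image of $a_\alpha$ in $\mathbb K$. Assume that $\Delta(f)$ has a loose edge $E$ and that (the image of) $f$ is irreducible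 in $\widehat R$. Then $E$ is the only compact edge of $\Delta(f)$, and $f|_E=cF^k$ for some $c\in\mathbb K^\times$, some irreducible polynomial $F\in\mathbb K[X_1,\dots,X_n]$ and some $k\in\mathbb Z_{\ge 0}$. Moreover, if $\mathbb K$ is algebraically closed, then there exist $a,b\in\mathbb K$, $k\in\mathbb Z_{\ge 0}$ and $\alpha,\beta\in\mathbb Z_{\ge 0}^n$ such that $f|_E=(a\underline X^\alpha+b\underline X^\beta)^k$ and $\alpha-\beta$ is a primitive lattice vector (its coordinates have greatest common divisor $1$). -/

import Mathlib

open scoped Pointwise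

noncomputable section

namespace LooseEdge

/-- `x = (x₁, …, xₙ)` is a regular system of parameters of the (regular) local ring `R`: it generates
the maximal ideal and its length is the Krull dimension of `R`. -/
structure IsRegularSystemOfParameters {R : Type*} [CommRing R] [IsLocalRing R] {n : ℕ}
    (x : Fin n → R) : Prop where
  span_range_eq : Ideal.span (Set.range x) = IsLocalRing.maximalIdeal R
  length_eq : (n : WithBot ℕ∞) = ringKrullDim R

/-- The finitely supported family `a` is an expansion of `f` with respect to `x`:
`f = ∑ a_α x^α`, a finite sum in which every coefficient `a_α` is a unit of `R` or zero. -/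
structure IsExpansion {R : Type*} [CommRing R] {n : ℕ} (x : Fin n → R) (f : R)
    (a : (Fin n →₀ ℕ) →₀ R) : Prop where
  isUnit_or_eq_zero : ∀ α, IsUnit (a α) ∨ a α = 0
  eq_sum : f = ∑ α ∈ a.support, a α * ∏ i, x i ^ α i

/-- An exponent vector `α ∈ ℤ_{≥0}^n`, viewed as a point of `ℝ^n`. -/
def toPoint {n : ℕ} (α : Fin n →₀ ℕ) : Fin n → ℝ := fun i => (α i : ℝ)

/-- The Newton polyhedron of an expansion: the convex hull of `{α : a_α ≠ 0} + ℝ_{≥0}^n`. -/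
def newtonPolyhedron {R : Type*} [CommRing R] {n : ℕ} (a : (Fin n →₀ ℕ) →₀ R) :
    Set (Fin n → ℝ) :=
  convexHull ℝ (toPoint '' {α | a α ≠ 0} + {v : Fin n → ℝ | ∀ i, 0 ≤ v i})

/-- `Δ^ξ`, the set of points of `Δ` at which `⟨ξ, ·⟩` attains its minimum over `Δ`. -/
def faceAt {n : ℕ} (Δ : Set (Fin n → ℝ)) (ξ : Fin n → ℝ) : Set (Fin n → ℝ) :=
  {p | p ∈ Δ ∧ ∀ q ∈ Δ, ξ ⬝ᵥ p ≤ ξ ⬝ᵥ q}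

/-- The faces of `Δ` are the sets `Δ^ξ` with `ξ ∈ ℝ_{≥0}^n`. -/
def IsFace {n : ℕ} (Δ A : Set (Fin n → ℝ)) : Prop :=
  ∃ ξ : Fin n → ℝ, (∀ i, 0 ≤ ξ i) ∧ A = faceAt Δ ξ

/-- The dimension of a (convex) set: the dimension of the direction of its affine span. -/
def faceDim {n : ℕ} (A : Set (Fin n → ℝ)) : ℕ :=
  Module.finrank ℝ (vectorSpan ℝ A)

/-- A compact edge: a compact face of dimension one. -/
def IsCompactEdge {n : ℕ} (Δ E : Set (Fin n → ℝ)) : Prop :=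
  IsFace Δ E ∧ IsCompact E ∧ faceDim E = 1

/-- A loose edge: a compact edge not contained in any compact face of dimension at least two. -/
def IsLooseEdge {n : ℕ} (Δ E : Set (Fin n → ℝ)) : Prop :=
  IsCompactEdge Δ E ∧ ∀ A, IsFace Δ A → IsCompact A → E ⊆ A → ¬ 2 ≤ faceDim A

open Classical in
/-- The symbolic restriction to `A` of an expansion: `∑_{α ∈ A} ā_α X^α`, where `ā_α` is the image
of `a_α` in the residue field. -/
def symbolicRestriction {R : Type*} [CommRing R] [IsLocalRing R] {n : ℕ}
    (a : (Fin n →₀ ℕ) →₀ R) (A : Set (Fin n → ℝ)) :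
    MvPolynomial (Fin n) (IsLocalRing.ResidueField R) :=
  ∑ α ∈ a.support with toPoint α ∈ A, MvPolynomial.monomial α (IsLocalRing.residue R (a α))

/-- A lattice vector is primitive if the greatest common divisor of its coordinates is one. -/
def IsPrimitiveVector {n : ℕ} (v : Fin n → ℤ) : Prop :=
  Finset.univ.gcd v = 1

end LooseEdge

end

/-! The exponents on a compact edge lie on a line. The edge is orthogonal to a strictly positive
vector, so its primitive direction has coordinates of both signs and is a - b with a, b nonzero,
nonnegative and of disjoint supports. Looseness forces every nonnegative covector orthogonal to the
edge to be minimal on it (`IsLooseEdge.le_dotProduct`): otherwise, tilting the normal vector towards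
such a covector would give a compact face of dimension at least two containing the edge. So f|_E is
the initial form of f for all extremal rays of the cone orthogonal to a - b at once; these rays form
the vector-valued weight `rayWeight`.

Hence f|_E = X^γ Φ(X^a, X^b), where Φ is the homogenization of a one-variable polynomial φ with φ(0)
≠ 0. By Hensel's lemma (`exists_lift_factorization`) a factorization G H of the initial form lifts
to the completion once every monomial of weight at least that of G H lies in the ideal (G, H). For a
coprime factorization φ = g h, with the part of γ on supp a attached to g and the part on supp b
attached to h, this membership is `monomial_mem_span_of_weight_le`, which rests on Bézout's identity
with degree bounds. A lifted factor of nonzero weight is not a unit, so irreducibility of f makes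
one of the two factors trivial. Variables outside both supports do not occur in X^γ, since otherwise
they would divide f; the factorizations 1 * φ and φ * 1 give γ = 0; the others give φ = c ψ^m with ψ
irreducible.

Because a - b is primitive, the form of ψ in X^a, X^b stays irreducible (`irreducible_binaryForm`).
Because γ = 0, the edge joins k a and k b with k = deg φ, and the ray inequalities put every
exponent in this segment plus the orthant, which leaves no room for another compact edge
(`eq_of_isCompactEdge`). Over an algebraically closed field ψ is linear and c is an m-th power. -/

namespace LooseEdge

/-! ### Successive approximation along filtrations by ideals. -/

section Filtration

variable {S : Type*} [CommRing S] (I : Ideal S)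

/-- A sequence whose increments lie in ideals that shrink adically has a limit. -/
theorem exists_limit_of_filtration [IsAdicComplete I S] {A : ℕ → Ideal S} (hA : Antitone A) {C : ℕ}
    (hC : ∀ N, A (C * N) ≤ I ^ N) {s : ℕ → S} (hs : ∀ w, s (w + 1) - s w ∈ A (w + 1)) :
    ∃ L, ∀ N, L - s (C * N) ∈ I ^ N := by
  have key : ∀ w d, s (w + d) - s w ∈ A w := by
    intro w d
    induction d with
    | zero => simp
    | succ d ih =>
      have := (A w).add_mem (hA (by omega) (hs (w + d))) ih
      simpa [add_assoc] using this
  -- Only the subsequence at the indices C * N is compared with the powers of I.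
  obtain ⟨L, hL⟩ := IsPrecomplete.prec (IsAdicComplete.toIsPrecomplete (I := I) (M := S))
    (f := fun N => s (C * N)) (by
      intro m n hmn
      rw [SModEq.sub_mem, smul_eq_mul, Ideal.mul_top, ← neg_sub]
      refine neg_mem (hC m ?_)
      obtain ⟨d, rfl⟩ := Nat.exists_eq_add_of_le hmn
      simpa [mul_add] using key (C * m) (C * d))
  refine ⟨L, fun N => ?_⟩
  have := hL N
  rw [SModEq.sub_mem, smul_eq_mul, Ideal.mul_top, ← neg_sub] at this
  simpa using neg_mem this

/-- Hensel lifting of a factorization along filtrations by ideals. -/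
theorem exists_mul_eq_of_filtration [IsAdicComplete I S] {A B D : ℕ → Ideal S}
    (hA : Antitone A) (hB : Antitone B) (hD : Antitone D) {C : ℕ}
    (hAC : ∀ N, A (C * N) ≤ I ^ N) (hBC : ∀ N, B (C * N) ≤ I ^ N) (hDC : ∀ N, D (C * N) ≤ I ^ N)
    (hA1 : A 1 ≤ I) (hB1 : B 1 ≤ I)
    (hAB : ∀ v w, ∀ x ∈ A v, ∀ y ∈ B w, x * y ∈ D (v + w)) {f g₀ h₀ : S}
    (hf : f - g₀ * h₀ ∈ D 1)
    (hstep : ∀ w, ∀ e ∈ D w, ∃ η ∈ B w, ∃ γ ∈ A w, e - (g₀ * η + h₀ * γ) ∈ D (w + 1)) :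
    ∃ g h, f = g * h ∧ g - g₀ ∈ I ∧ h - h₀ ∈ I := by
  let T (w : ℕ) := {p : S × S // f - p.1 * p.2 ∈ D (w + 1) ∧ p.1 - g₀ ∈ A 1 ∧ p.2 - h₀ ∈ B 1}
  have hnext : ∀ w (p : T w), ∃ q : T (w + 1),
      q.1.1 - p.1.1 ∈ A (w + 1) ∧ q.1.2 - p.1.2 ∈ B (w + 1) := by
    -- The correction is found using the fixed pair (g₀, h₀) instead of (g, h). The error (g - g₀) η
    -- + γ (h - h₀) + γ η still has order at least w + 2, because g - g₀ and h - h₀ have order at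
    -- least 1.
    rintro w ⟨⟨g, h⟩, h1, h2, h3⟩
    obtain ⟨η, hη, γ, hγ, he⟩ := hstep (w + 1) _ h1
    dsimp only at h1 h2 h3 he
    refine ⟨⟨(g + γ, h + η), ?_, ?_, ?_⟩, by simpa using hγ, by simpa using hη⟩
    · have e1 := hAB _ _ _ h2 _ hη
      have e2 := hAB _ _ _ hγ _ h3
      have e3 := hD (show w + 1 + 1 ≤ w + 1 + (w + 1) by omega) (hAB _ _ _ hγ _ hη)
      have : f - (g + γ) * (h + η) = (f - g * h - (g₀ * η + h₀ * γ)) - (g - g₀) * η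
          - γ * (h - h₀) - γ * η := by ring
      dsimp only
      rw [this]
      refine sub_mem (sub_mem (sub_mem he ?_) ?_) e3
      · rwa [add_comm] at e1
      · exact e2
    · have := add_mem h2 (hA (by omega : 1 ≤ w + 1) hγ)
      dsimp only
      convert this using 1; ring
    · have := add_mem h3 (hB (by omega : 1 ≤ w + 1) hη)
      dsimp only
      convert this using 1; ring
  choose next hn1 hn2 using hnext
  let s : (w : ℕ) → T w := fun w => Nat.rec ⟨(g₀, h₀), by simpa using hf, by simp, by simp⟩
    (fun w p => next w p) w
  obtain ⟨g, hg⟩ := exists_limit_of_filtration I hA hAC (s := fun w => (s w).1.1)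
    (fun w => hn1 w (s w))
  obtain ⟨h, hh⟩ := exists_limit_of_filtration I hB hBC (s := fun w => (s w).1.2)
    (fun w => hn2 w (s w))
  refine ⟨g, h, ?_, ?_, ?_⟩
  · rw [← sub_eq_zero]
    refine IsHausdorff.haus (IsAdicComplete.toIsHausdorff (I := I) (M := S)) _ fun N => ?_
    rw [SModEq.zero, smul_eq_mul, Ideal.mul_top]
    have e : f - g * h = (f - (s (C * N)).1.1 * (s (C * N)).1.2)
        - (g - (s (C * N)).1.1) * h - (h - (s (C * N)).1.2) * (s (C * N)).1.1 := by ring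
    rw [e]
    exact sub_mem (sub_mem (hDC N (hD (by omega) (s (C * N)).2.1))
      (Ideal.mul_mem_right _ _ (hg N))) (Ideal.mul_mem_right _ _ (hh N))
  · have := add_mem (pow_one I ▸ hg 1) (hA1 (s (C * 1)).2.2.1)
    convert this using 1; ring
  · have := add_mem (pow_one I ▸ hh 1) (hB1 (s (C * 1)).2.2.2)
    convert this using 1; ring

end Filtration

end LooseEdge

namespace LooseEdge

open MvPolynomial

/-! ### Vector-valued weights and the ideals they define. -/

section Weights

variable {σ ι : Type*}

/-- Used to replace the cofactors in an ideal membership by single homogeneous components. -/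
theorem weightedHomogeneousComponent_mul_of_left {A : Type*} [CommRing A] (w : σ → ι → ℕ)
    {G : MvPolynomial σ A} {m : ι → ℕ} (hG : IsWeightedHomogeneous w G m) (p : MvPolynomial σ A)
    (d : ι → ℕ) :
    weightedHomogeneousComponent w (m + d) (G * p) = G * weightedHomogeneousComponent w d p := by
  classical
  let _ := weightedGradedAlgebra A w
  have := DirectSum.coe_decompose_mul_add_of_left_mem (weightedHomogeneousSubmodule A w)
    (i := m) (j := d) (a := G) (b := p) hG
  rw [← weightedDecomposition.decompose'_apply, ← weightedDecomposition.decompose'_apply]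
  exact this

/-- A weighted homogeneous polynomial lifts to a weighted homogeneous polynomial. -/
theorem exists_homogeneous_lift {A B : Type*} [CommRing A] [CommRing B] {f : A →+* B}
    (hf : Function.Surjective f) {w : σ → ι → ℕ} {p : MvPolynomial σ B} {m : ι → ℕ}
    (hp : IsWeightedHomogeneous w p m) :
    ∃ q : MvPolynomial σ A, map f q = p ∧ IsWeightedHomogeneous w q m := by
  classical
  obtain ⟨q, rfl⟩ := map_surjective f hf p
  refine ⟨weightedHomogeneousComponent w m q, ?_,
    weightedHomogeneousComponent_isWeightedHomogeneous ..⟩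
  ext d
  rw [coeff_map, coeff_weightedHomogeneousComponent]
  split_ifs with h
  · rw [coeff_map]
  · rw [map_zero, hp.coeff_eq_zero d h]

variable [Fintype ι]

/-- The sum of all the weights of an exponent vector. -/
noncomputable def totalWeight (w : σ → ι → ℕ) (δ : σ →₀ ℕ) : ℕ := ∑ j, Finsupp.weight w δ j

theorem totalWeight_add (w : σ → ι → ℕ) (δ ε : σ →₀ ℕ) :
    totalWeight w (δ + ε) = totalWeight w δ + totalWeight w ε := by
  simp [totalWeight, Finset.sum_add_distrib]

theorem one_le_totalWeight_single {w : σ → ι → ℕ} (hw : ∀ i, w i ≠ 0) (i : σ) :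
    1 ≤ totalWeight w (Finsupp.single i 1) := by
  obtain ⟨j, hj⟩ := Function.ne_iff.mp (hw i)
  simp only [totalWeight, Finsupp.weight_single, one_smul]
  exact (Nat.one_le_iff_ne_zero.mpr hj).trans
    (Finset.single_le_sum (f := fun j => w i j) (fun _ _ => Nat.zero_le _) (Finset.mem_univ j))

theorem exists_totalWeight_le [Fintype σ] (w : σ → ι → ℕ) :
    ∃ C, 1 ≤ C ∧ ∀ δ : σ →₀ ℕ, totalWeight w δ ≤ C * δ.degree := by
  refine ⟨1 + ∑ i, ∑ j, w i j, by omega, fun δ => ?_⟩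
  have : totalWeight w δ = ∑ i, δ i * ∑ j, w i j := by
    simp only [totalWeight, Finsupp.weight_eq_sum, Finset.sum_apply, Pi.smul_apply, smul_eq_mul]
    rw [Finset.sum_comm]
    simp [Finset.mul_sum]
  rw [this, Finsupp.degree_eq_sum, Finset.mul_sum]
  refine Finset.sum_le_sum fun i _ => ?_
  rw [mul_comm]
  refine Nat.mul_le_mul_right _ ?_
  have := Finset.single_le_sum (f := fun i => ∑ j, w i j) (fun _ _ => Nat.zero_le _)
    (Finset.mem_univ i)
  omega

variable {S : Type*} [CommRing S]

/-- The ideal generated by the monomials whose weight is at least `m` and whose total weight exceeds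
that of `m` by at least `t`. -/
def weightIdeal (w : σ → ι → ℕ) (y : σ → S) (m : ι → ℕ) (t : ℕ) : Ideal S :=
  Ideal.span {s | ∃ δ : σ →₀ ℕ, m ≤ Finsupp.weight w δ ∧ ∑ j, m j + t ≤ totalWeight w δ ∧
    s = δ.prod fun i e => y i ^ e}

theorem weightIdeal_antitone (w : σ → ι → ℕ) (y : σ → S) (m : ι → ℕ) :
    Antitone (weightIdeal w y m) := by
  intro s t hst
  refine Ideal.span_mono ?_
  rintro _ ⟨δ, h1, h2, rfl⟩
  exact ⟨δ, h1, by omega, rfl⟩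

theorem mul_mem_weightIdeal {w : σ → ι → ℕ} {y : σ → S} {m m' : ι → ℕ} {t t' : ℕ} {a b : S}
    (ha : a ∈ weightIdeal w y m t) (hb : b ∈ weightIdeal w y m' t') :
    a * b ∈ weightIdeal w y (m + m') (t + t') := by
  have : weightIdeal w y m t * weightIdeal w y m' t' ≤ weightIdeal w y (m + m') (t + t') := by
    rw [weightIdeal, weightIdeal, Ideal.span_mul_span']
    refine Ideal.span_mono ?_
    rintro _ ⟨_, ⟨δ, h1, h2, rfl⟩, _, ⟨ε, h3, h4, rfl⟩, rfl⟩
    refine ⟨δ + ε, ?_, ?_, ?_⟩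
    · rw [map_add]; exact add_le_add h1 h3
    · rw [totalWeight_add]; simp only [Pi.add_apply, Finset.sum_add_distrib]; omega
    · exact (Finsupp.prod_add_index' (by simp) (by intros; rw [pow_add])).symm
  exact this (Ideal.mul_mem_mul ha hb)

theorem prod_pow_mem_pow_degree {I : Ideal S} {y : σ → S} (hy : ∀ i, y i ∈ I) (δ : σ →₀ ℕ) :
    (δ.prod fun i e => y i ^ e) ∈ I ^ δ.degree := by
  rw [Finsupp.degree_apply, ← Finset.prod_pow_eq_pow_sum, Finsupp.prod]
  exact Ideal.prod_mem_prod fun i _ => Ideal.pow_mem_pow (hy i) _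

/-- A monomial of total weight at least C * N has degree at least N. This is what makes
approximation by weight converge adically. -/
theorem weightIdeal_le_pow {I : Ideal S} {y : σ → S} (hy : ∀ i, y i ∈ I) {w : σ → ι → ℕ} {C : ℕ}
    (hC1 : 1 ≤ C) (hC : ∀ δ : σ →₀ ℕ, totalWeight w δ ≤ C * δ.degree) (m : ι → ℕ) (N : ℕ) :
    weightIdeal w y m (C * N) ≤ I ^ N := by
  rw [weightIdeal, Ideal.span_le]
  rintro _ ⟨δ, -, h, rfl⟩
  refine Ideal.pow_le_pow_right ?_ (prod_pow_mem_pow_degree hy δ)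
  have := hC δ
  exact Nat.le_of_mul_le_mul_left (by omega : C * N ≤ C * δ.degree) (by omega)

theorem weightIdeal_le {I : Ideal S} {y : σ → S} (hy : ∀ i, y i ∈ I) {w : σ → ι → ℕ}
    {m : ι → ℕ} {t : ℕ} (ht : 1 ≤ ∑ j, m j + t) : weightIdeal w y m t ≤ I := by
  rw [weightIdeal, Ideal.span_le]
  rintro _ ⟨δ, -, h, rfl⟩
  refine Ideal.pow_le_self ?_ (prod_pow_mem_pow_degree hy δ)
  intro h0
  rw [Finsupp.degree_eq_zero_iff] at h0
  subst h0
  simp [totalWeight] at h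
  simp_all

variable {R : Type*} [CommRing R] [Algebra R S]

/-- A coefficient in the ideal of the `x i` counts as one more step of the filtration, since each
variable has nonzero weight. -/
theorem smul_monomial_mem_weightIdeal {w : σ → ι → ℕ} (hw : ∀ i, w i ≠ 0) {x : σ → R}
    {m : ι → ℕ} {t : ℕ} {δ : σ →₀ ℕ} (h1 : m ≤ Finsupp.weight w δ)
    (h2 : ∑ j, m j + t ≤ totalWeight w δ + 1) {c : R} (hc : c ∈ Ideal.span (Set.range x)) :
    algebraMap R S c * (δ.prod fun i e => (algebraMap R S (x i)) ^ e) ∈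
      weightIdeal w (fun i => algebraMap R S (x i)) m t := by
  induction hc using Submodule.span_induction with
  | mem c hc =>
    obtain ⟨i, rfl⟩ := hc
    refine Ideal.subset_span ⟨δ + Finsupp.single i 1, ?_, ?_, ?_⟩
    · rw [map_add]; exact h1.trans (le_add_of_nonneg_right (zero_le))
    · have := one_le_totalWeight_single hw i
      rw [totalWeight_add]; omega
    · rw [Finsupp.prod_add_index' (by simp) (by intros; rw [pow_add]), mul_comm]
      simp
  | zero => simp
  | add a b _ _ ha hb => rw [map_add, add_mul]; exact add_mem ha hb
  | smul a b _ hb =>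
    rw [smul_eq_mul, map_mul, mul_assoc]
    exact Ideal.mul_mem_left _ _ hb

theorem aeval_mem_weightIdeal {w : σ → ι → ℕ} (hw : ∀ i, w i ≠ 0) {x : σ → R}
    {m : ι → ℕ} {t : ℕ} {r : MvPolynomial σ R}
    (hr : ∀ δ, r.coeff δ ≠ 0 → m ≤ Finsupp.weight w δ ∧ (∑ j, m j + t ≤ totalWeight w δ ∨
      r.coeff δ ∈ Ideal.span (Set.range x) ∧ ∑ j, m j + t ≤ totalWeight w δ + 1)) :
    aeval (fun i => algebraMap R S (x i)) r ∈
      weightIdeal w (fun i => algebraMap R S (x i)) m t := by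
  rw [r.as_sum, map_sum]
  refine Ideal.sum_mem _ fun δ hδ => ?_
  rw [aeval_monomial]
  obtain ⟨h1, h2 | ⟨h2, h3⟩⟩ := hr δ (mem_support_iff.mp hδ)
  · exact Ideal.mul_mem_left _ _ (Ideal.subset_span ⟨δ, h1, h2, rfl⟩)
  · exact smul_monomial_mem_weightIdeal hw h1 h3 h2

theorem aeval_mem_weightIdeal_of_homogeneous {w : σ → ι → ℕ} (hw : ∀ i, w i ≠ 0) {x : σ → R}
    {m m' : ι → ℕ} {t : ℕ} {r : MvPolynomial σ R} (hr : IsWeightedHomogeneous w r m')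
    (h1 : m ≤ m') (h2 : ∑ j, m j + t ≤ ∑ j, m' j) :
    aeval (fun i => algebraMap R S (x i)) r ∈
      weightIdeal w (fun i => algebraMap R S (x i)) m t := by
  refine aeval_mem_weightIdeal hw fun δ hδ => ?_
  have := hr hδ
  rw [totalWeight, this]
  exact ⟨h1, .inl h2⟩

end Weights

/-! ### Lifting a factorization of the initial form. -/

section Hensel

variable {σ ι : Type*} [Fintype σ] [Fintype ι] {R S : Type*} [CommRing R] [IsLocalRing R]
  [CommRing S] [Algebra R S]

open IsLocalRing

/-- Hensel's lemma for a multi-weighted initial form: if every monomial of weight at least that of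
`G * H` lies in the ideal `(G, H)`, then the factorization `G * H` of the initial form of `f` lifts. -/
theorem exists_lift_factorization [IsAdicComplete ((maximalIdeal R).map (algebraMap R S)) S]
    {x : σ → R} (hx : Ideal.span (Set.range x) = maximalIdeal R)
    {w : σ → ι → ℕ} (hw : ∀ i, w i ≠ 0) {G H : MvPolynomial σ (ResidueField R)} {m₁ m₂ : ι → ℕ}
    (hG : IsWeightedHomogeneous w G m₁) (hH : IsWeightedHomogeneous w H m₂)
    (hGH : ∀ δ, m₁ + m₂ ≤ Finsupp.weight w δ → monomial δ 1 ∈ Ideal.span {G, H})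
    {f : MvPolynomial σ R} (hf : ∀ δ, f.coeff δ ≠ 0 → m₁ + m₂ ≤ Finsupp.weight w δ)
    (hfGH : ∀ δ, Finsupp.weight w δ = m₁ + m₂ → residue R (f.coeff δ) = (G * H).coeff δ) :
    ∃ g h : S, aeval (fun i => algebraMap R S (x i)) f = g * h ∧
      (m₁ ≠ 0 → g ∈ (maximalIdeal R).map (algebraMap R S)) ∧
      (m₂ ≠ 0 → h ∈ (maximalIdeal R).map (algebraMap R S)) := by
  classical
  set I := (maximalIdeal R).map (algebraMap R S)
  set y : σ → S := fun i => algebraMap R S (x i) with hy_def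
  have hy : ∀ i, y i ∈ I := fun i => Ideal.mem_map_of_mem _
    (hx ▸ Ideal.subset_span (Set.mem_range_self i))
  obtain ⟨C, hC1, hC⟩ := exists_totalWeight_le w
  obtain ⟨G', rfl, hG'⟩ := exists_homogeneous_lift residue_surjective hG
  obtain ⟨H', rfl, hH'⟩ := exists_homogeneous_lift residue_surjective hH
  have hlt : ∀ {m m' : ι → ℕ}, m ≤ m' → m ≠ m' → ∑ j, m j + 1 ≤ ∑ j, m' j := by
    intro m m' h1 h2
    obtain ⟨j, hj⟩ := Function.ne_iff.mp h2
    exact Finset.sum_lt_sum (fun j _ => h1 j) ⟨j, Finset.mem_univ j, lt_of_le_of_ne (h1 j) hj⟩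
  have hmem : ∀ {c : R}, residue R c = 0 → c ∈ Ideal.span (Set.range x) := fun h => by
    rwa [hx, ← residue_eq_zero_iff]
  have h0G : aeval y G' ∈ weightIdeal w y m₁ 0 :=
    aeval_mem_weightIdeal_of_homogeneous hw hG' le_rfl (by simp)
  have h0H : aeval y H' ∈ weightIdeal w y m₂ 0 :=
    aeval_mem_weightIdeal_of_homogeneous hw hH' le_rfl (by simp)
  obtain ⟨g, h, e1, e2, e3⟩ := exists_mul_eq_of_filtration I (A := weightIdeal w y m₁)
    (B := weightIdeal w y m₂) (D := weightIdeal w y (m₁ + m₂)) (f := aeval y f)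
    (g₀ := aeval y G') (h₀ := aeval y H')
    (weightIdeal_antitone ..) (weightIdeal_antitone ..) (weightIdeal_antitone ..)
    (weightIdeal_le_pow hy hC1 hC _) (weightIdeal_le_pow hy hC1 hC _)
    (weightIdeal_le_pow hy hC1 hC _) (weightIdeal_le hy (by omega)) (weightIdeal_le hy (by omega))
    (fun _ _ _ ha _ hb => mul_mem_weightIdeal ha hb) (by
      rw [← map_mul, ← map_sub]
      refine aeval_mem_weightIdeal hw fun δ hδ => ?_
      by_cases hδm : Finsupp.weight w δ = m₁ + m₂
      · refine ⟨hδm.ge, .inr ⟨hmem ?_, ?_⟩⟩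
        · rw [coeff_sub, map_sub, hfGH δ hδm, ← map_mul, coeff_map, sub_self]
        · rw [totalWeight, hδm]
      · rw [coeff_sub, (hG'.mul hH').coeff_eq_zero δ hδm, sub_zero] at hδ
        exact ⟨hf δ hδ, .inl (hlt (hf δ hδ) (Ne.symm hδm))⟩) (by
      intro t e he
      induction he using Submodule.span_induction with
      | mem e he =>
        obtain ⟨δ, h1, h2, rfl⟩ := he
        by_cases h3 : ∑ j, (m₁ + m₂) j + (t + 1) ≤ totalWeight w δ
        · refine ⟨0, zero_mem _, 0, zero_mem _, ?_⟩
          rw [mul_zero, mul_zero, add_zero, sub_zero]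
          exact Ideal.subset_span ⟨δ, h1, h3, rfl⟩
        -- The remaining monomials exceed the weight by exactly t in total. Only the components of
        -- weights m₂ + d and m₁ + d of the cofactors matter. Their homogeneous lifts leave an error
        -- of the same weight with coefficients in the maximal ideal, which is one filtration step
        -- deeper.
        obtain ⟨d, hd⟩ := exists_add_of_le h1
        have hdt : ∑ j, d j = t := by
          have : totalWeight w δ = ∑ j, (m₁ + m₂) j + ∑ j, d j := by
            rw [totalWeight, hd, ← Finset.sum_add_distrib]; rfl
          omega
        obtain ⟨A, B, hAB⟩ := Ideal.mem_span_pair.mp (hGH δ h1)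
        have hcomp : map (residue R) G' * weightedHomogeneousComponent w (m₂ + d) A +
            map (residue R) H' * weightedHomogeneousComponent w (m₁ + d) B = monomial δ 1 := by
          rw [← weightedHomogeneousComponent_mul_of_left w hG,
            ← weightedHomogeneousComponent_mul_of_left w hH,
            show m₁ + (m₂ + d) = m₁ + m₂ + d by ring, show m₂ + (m₁ + d) = m₁ + m₂ + d by ring,
            ← map_add, mul_comm _ A, mul_comm _ B, hAB]
          exact IsWeightedHomogeneous.weightedHomogeneousComponent_same
            (isWeightedHomogeneous_monomial w δ 1 hd)
        obtain ⟨A', hA1, hA2⟩ := exists_homogeneous_lift (residue_surjective (R := R))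
          (weightedHomogeneousComponent_isWeightedHomogeneous (w := w) (m₂ + d) A)
        obtain ⟨B', hB1, hB2⟩ := exists_homogeneous_lift (residue_surjective (R := R))
          (weightedHomogeneousComponent_isWeightedHomogeneous (w := w) (m₁ + d) B)
        rw [← hA1, ← hB1] at hcomp
        refine ⟨aeval y A', aeval_mem_weightIdeal_of_homogeneous hw hA2 le_self_add ?_,
          aeval y B', aeval_mem_weightIdeal_of_homogeneous hw hB2 le_self_add ?_, ?_⟩
        · simp [Finset.sum_add_distrib, hdt]
        · simp [Finset.sum_add_distrib, hdt]
        have : (δ.prod fun i e => y i ^ e) = aeval y (monomial δ (1 : R)) := by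
          simp [aeval_monomial]
        rw [this, ← map_mul, ← map_mul, ← map_add, ← map_sub]
        refine aeval_mem_weightIdeal hw fun ε hε => ?_
        have hr : IsWeightedHomogeneous w (monomial δ 1 - (G' * A' + H' * B')) (m₁ + m₂ + d) := by
          refine (isWeightedHomogeneous_monomial w δ 1 hd).sub (.add ?_ ?_)
          · convert hG'.mul hA2 using 1; ring
          · convert hH'.mul hB2 using 1; ring
        have hε' := hr hε
        refine ⟨hε' ▸ le_self_add, .inr ⟨hmem ?_, ?_⟩⟩
        · rw [← coeff_map, map_sub, map_add, map_mul, map_mul, hcomp]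
          simp
        · rw [totalWeight, hε']
          simp only [Pi.add_apply, Finset.sum_add_distrib] at *
          omega
      | zero => exact ⟨0, zero_mem _, 0, zero_mem _, by simp⟩
      | add a b _ _ ha hb =>
        obtain ⟨η, hη, γ, hγ, h⟩ := ha
        obtain ⟨η', hη', γ', hγ', h'⟩ := hb
        refine ⟨η + η', add_mem hη hη', γ + γ', add_mem hγ hγ', ?_⟩
        convert add_mem h h' using 1
        ring
      | smul c a _ ha =>
        obtain ⟨η, hη, γ, hγ, h⟩ := ha
        refine ⟨c * η, Ideal.mul_mem_left _ _ hη, c * γ, Ideal.mul_mem_left _ _ hγ, ?_⟩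
        convert Ideal.mul_mem_left _ c h using 1
        rw [smul_eq_mul]; ring)
  have hpos : ∀ {m : ι → ℕ}, m ≠ 0 → 1 ≤ ∑ j, m j + 0 := fun hm => by
    have := hlt (zero_le) (Ne.symm hm)
    simpa using this
  refine ⟨g, h, e1, fun hm => ?_, fun hm => ?_⟩
  · have := add_mem e2 (weightIdeal_le hy (hpos hm) h0G)
    simpa using this
  · have := add_mem e3 (weightIdeal_le hy (hpos hm) h0H)
    simpa using this

end Hensel

end LooseEdge

namespace LooseEdge

open MvPolynomial

/-! ### Binary forms in two monomials, and Bézout's identity for them. -/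

section BinaryForm

variable {σ K : Type*}

/-- The binary form of degree `d` with dehomogenization `φ`, evaluated at the monomials `X^a`, `X^b`:
`∑ φᵢ X^(i a + (d - i) b)`. -/
noncomputable def binaryForm [CommRing K] (a b : σ →₀ ℕ) (d : ℕ) (φ : Polynomial K) :
    MvPolynomial σ K :=
  aeval ![monomial a 1, monomial b 1] (φ.homogenize d)

section Ring

variable [CommRing K] (a b : σ →₀ ℕ)

theorem binaryForm_eq_sum (d : ℕ) (φ : Polynomial K) :
    binaryForm a b d φ =
      ∑ i ∈ Finset.range (d + 1), monomial (i • a + (d - i) • b) (φ.coeff i) := by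
  rw [binaryForm, Polynomial.homogenize, map_sum, Finset.Nat.sum_antidiagonal_eq_sum_range_succ_mk]
  refine Finset.sum_congr rfl fun i _ => ?_
  rw [aeval_monomial]
  simp [monomial_pow, Finsupp.prod_fintype, Fin.prod_univ_two, monomial_mul, algebraMap_eq,
    C_mul_monomial]

theorem binaryForm_add (d : ℕ) (φ ψ : Polynomial K) :
    binaryForm a b d (φ + ψ) = binaryForm a b d φ + binaryForm a b d ψ := by
  simp [binaryForm]

theorem binaryForm_zero (d : ℕ) : binaryForm a b d (0 : Polynomial K) = 0 := by
  simp [binaryForm]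

theorem binaryForm_mul {d e : ℕ} {φ ψ : Polynomial K} (hφ : φ.natDegree ≤ d)
    (hψ : ψ.natDegree ≤ e) :
    binaryForm a b (d + e) (φ * ψ) = binaryForm a b d φ * binaryForm a b e ψ := by
  simp [binaryForm, Polynomial.homogenize_mul _ _ hφ hψ]

theorem binaryForm_C (c : K) : binaryForm a b 0 (Polynomial.C c) = C c := by
  simp [binaryForm, algebraMap_eq]

theorem binaryForm_one : binaryForm a b 0 (1 : Polynomial K) = 1 := by
  simpa using binaryForm_C a b (1 : K)

theorem binaryForm_X_pow (i j : ℕ) :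
    binaryForm a b (i + j) (Polynomial.X ^ i : Polynomial K) = monomial (i • a + j • b) 1 := by
  rw [binaryForm, Polynomial.homogenize_X_pow (by omega)]
  simp [monomial_pow, monomial_mul]

theorem binaryForm_pow {d : ℕ} {φ : Polynomial K} (hφ : φ.natDegree ≤ d) (k : ℕ) :
    binaryForm a b (k * d) (φ ^ k) = binaryForm a b d φ ^ k := by
  induction k with
  | zero => simp [binaryForm_one]
  | succ k ih =>
    rw [pow_succ, pow_succ, add_mul, one_mul,
      binaryForm_mul a b (Polynomial.natDegree_pow_le_of_le k hφ) hφ, ih]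

theorem binaryForm_mul_X_pow {d : ℕ} {φ : Polynomial K} (hφ : φ.natDegree ≤ d) (r : ℕ) :
    binaryForm a b (d + r) (φ * Polynomial.X ^ r) = binaryForm a b d φ * monomial (r • a) 1 := by
  rw [binaryForm_mul a b hφ (Polynomial.natDegree_X_pow_le r)]
  congr 1
  simpa using binaryForm_X_pow (K := K) a b r 0

theorem binaryForm_add_degree {d : ℕ} {φ : Polynomial K} (hφ : φ.natDegree ≤ d) (r : ℕ) :
    binaryForm a b (d + r) φ = binaryForm a b d φ * monomial (r • b) 1 := by
  have := binaryForm_mul a b hφ (ψ := 1) (e := r) (by simp)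
  rw [mul_one] at this
  rw [this]
  congr 1
  simpa using binaryForm_X_pow (K := K) a b 0 r

/-- The strict bound on A allows homogenizing it in degree s - 1, and N = d + (s - 1); for s = 0 it
forces A = 0. -/
theorem exists_binaryForm_mul_eq {N d s : ℕ} (hN : N + 1 = d + s) {ψ A : Polynomial K}
    (hψ : ψ.natDegree ≤ d) (hA : A.degree < s) :
    ∃ c, binaryForm a b N (ψ * A) = binaryForm a b d ψ * c := by
  obtain _ | s := s
  · have : A = 0 := by
      by_contra h
      rw [Polynomial.degree_eq_natDegree h] at hA
      exact absurd (Nat.cast_lt.mp hA) (by omega)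
    exact ⟨0, by simp [this, binaryForm_zero]⟩
  · obtain rfl : N = d + s := by omega
    refine ⟨_, binaryForm_mul a b hψ (Polynomial.natDegree_le_iff_coeff_eq_zero.mpr fun i hi => ?_)⟩
    exact Polynomial.coeff_eq_zero_of_degree_lt (hA.trans_le (by exact_mod_cast hi))

end Ring

section Field

variable [Field K]

/-- Bézout's identity with degree bounds. -/
theorem exists_bezout_degree_lt {g h θ : Polynomial K} (hg : g ≠ 0) (hgh : IsCoprime g h) {N s : ℕ}
    (hN : g.natDegree + s = N + 1) (hh : h.natDegree ≤ s) (hθ : θ.natDegree ≤ N) :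
    ∃ A B, θ = g * A + h * B ∧ B.degree < g.natDegree ∧ A.degree < s := by
  obtain ⟨u, v, huv⟩ := hgh
  -- Reducing the cofactor of h modulo g bounds its degree; the bound on the other cofactor A then
  -- follows from g * A = θ - h * B, where both terms have degree less than N + 1.
  set B := (v * θ) % g with hB
  have hBdeg : B.degree < g.natDegree := by
    rw [← Polynomial.degree_eq_natDegree hg]
    exact EuclideanDomain.mod_lt _ hg
  refine ⟨u * θ + h * ((v * θ) / g), B, ?_, hBdeg, ?_⟩
  · have h1 := EuclideanDomain.div_add_mod (v * θ) g
    have h2 : θ = (u * g + v * h) * θ := by rw [huv, one_mul]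
    linear_combination h2 - h * h1
  · set A := u * θ + h * ((v * θ) / g)
    have hgA : g * A = θ - h * B := by
      have h1 := EuclideanDomain.div_add_mod (v * θ) g
      have h2 : θ = (u * g + v * h) * θ := by rw [huv, one_mul]
      linear_combination h * h1 - h2
    have hlt : (g * A).degree < (N + 1 : ℕ) := by
      rw [hgA]
      refine (Polynomial.degree_sub_le _ _).trans_lt (max_lt ?_ ?_)
      · exact Polynomial.degree_le_natDegree.trans_lt (by exact_mod_cast Nat.lt_succ_of_le hθ)
      · rw [← hN, Polynomial.degree_mul, add_comm, Nat.cast_add]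
        by_cases hh0 : h = 0
        · simp [hh0, WithBot.bot_lt_iff_ne_bot]
        · exact WithBot.add_lt_add_of_lt_of_le (by simpa using hh0) hBdeg
            (Polynomial.degree_le_natDegree.trans (by exact_mod_cast hh))
    by_cases hA0 : A = 0
    · rw [hA0, Polynomial.degree_zero]; exact WithBot.bot_lt_coe _
    rw [Polynomial.degree_eq_natDegree (mul_ne_zero hg hA0),
      Polynomial.natDegree_mul hg hA0] at hlt
    rw [Polynomial.degree_eq_natDegree hA0]
    have := Nat.cast_lt.mp hlt
    exact_mod_cast (by omega : A.natDegree < s)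

/-- A criterion for a monomial to lie in the ideal generated by the products of monomials with two
coprime binary forms in `X^a` and `X^b`. -/
theorem monomial_mem_span_of_le {a b : σ →₀ ℕ} {g h : Polynomial K} (hgh : IsCoprime g h)
    (hg : g ≠ 0) (hh : h.coeff 0 ≠ 0) {δ γ₁ γ₂ : σ →₀ ℕ} {m l r s : ℕ}
    (hsum : m + l + 1 = g.natDegree + h.natDegree + r + s) (hδ : m • a + l • b ≤ δ)
    (h₁ : γ₁ + m • a + l • b ≤ δ + r • a) (h₂ : γ₂ + m • a + l • b ≤ δ + s • b) :
    monomial δ (1 : K) ∈ Ideal.span {monomial γ₁ 1 * binaryForm a b g.natDegree g,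
      monomial γ₂ 1 * binaryForm a b h.natDegree h} := by
  -- In homogeneous terms, X^m Y^l is a combination of the forms X^r g and Y^s h, its degree being
  -- one less than the sum of theirs. The factor Y^s disappears on dehomogenizing and survives only
  -- in the degree bounds; X^r does not spoil coprimality because h(0) ≠ 0.
  have hX : IsCoprime (g * Polynomial.X ^ r) h := by
    refine IsCoprime.mul_left hgh (IsCoprime.pow_left ?_)
    refine (Polynomial.irreducible_X.coprime_iff_not_dvd).mpr ?_
    rwa [Polynomial.X_dvd_iff]
  have hgX : g * Polynomial.X ^ r ≠ 0 := mul_ne_zero hg (pow_ne_zero _ Polynomial.X_ne_zero)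
  have hdeg : (g * Polynomial.X ^ r).natDegree = g.natDegree + r := by
    rw [Polynomial.natDegree_mul_X_pow _ hg]
  obtain ⟨A, B, hAB, hB, hA⟩ := exists_bezout_degree_lt (θ := Polynomial.X ^ m) (N := m + l)
    (s := h.natDegree + s) hgX hX (by omega) (by omega)
    ((Polynomial.natDegree_X_pow_le m).trans (by omega))
  obtain ⟨c₁, hc₁⟩ := exists_binaryForm_mul_eq a b (N := m + l) (d := g.natDegree + r)
    (s := h.natDegree + s) (by omega) hdeg.le hA
  obtain ⟨c₂, hc₂⟩ := exists_binaryForm_mul_eq a b (N := m + l) (d := h.natDegree + s)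
    (ψ := h) (s := g.natDegree + r) (by omega) (by omega) (hdeg ▸ hB)
  rw [binaryForm_mul_X_pow a b le_rfl] at hc₁
  rw [binaryForm_add_degree a b le_rfl] at hc₂
  obtain ⟨δ', rfl⟩ := exists_add_of_le hδ
  obtain ⟨ε₁, hε₁⟩ := exists_add_of_le <| show γ₁ ≤ δ' + r • a from by
    refine le_of_add_le_add_left (a := m • a + l • b) ?_
    convert h₁ using 1 <;> abel
  obtain ⟨ε₂, hε₂⟩ := exists_add_of_le <| show γ₂ ≤ δ' + s • b from by
    refine le_of_add_le_add_left (a := m • a + l • b) ?_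
    convert h₂ using 1 <;> abel
  have e₁ : (monomial δ' (1 : K)) * monomial (r • a) 1 = monomial γ₁ 1 * monomial ε₁ 1 := by
    rw [monomial_mul, monomial_mul, hε₁]
  have e₂ : (monomial δ' (1 : K)) * monomial (s • b) 1 = monomial γ₂ 1 * monomial ε₂ 1 := by
    rw [monomial_mul, monomial_mul, hε₂]
  have e₃ : (monomial (m • a + l • b + δ') (1 : K)) =
      monomial (m • a + l • b) 1 * monomial δ' 1 := by
    rw [monomial_mul, one_mul]
  rw [e₃, ← binaryForm_X_pow, hAB, binaryForm_add, hc₁, hc₂, Ideal.mem_span_pair]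
  refine ⟨c₁ * monomial ε₁ 1, c₂ * monomial ε₂ 1, ?_⟩
  linear_combination (-c₁ * binaryForm a b g.natDegree g) * e₁ -
    c₂ * binaryForm a b h.natDegree h * e₂

end Field

end BinaryForm

end LooseEdge

namespace LooseEdge

open MvPolynomial

/-! ### Factors of weighted homogeneous polynomials. -/

section Homogeneous

variable {σ ι K : Type*} [Field K]

/-- The ring homomorphism `X_i ↦ X_i T^(w i)` recording weights. -/
noncomputable def weightHom (w : σ → ℕ) : MvPolynomial σ K →ₐ[K] Polynomial (MvPolynomial σ K) :=
  aeval fun i => Polynomial.C (X i) * Polynomial.X ^ w i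

theorem weightHom_monomial (w : σ → ℕ) (δ : σ →₀ ℕ) (c : K) :
    weightHom w (monomial δ c) = Polynomial.monomial (Finsupp.weight w δ) (monomial δ c) := by
  rw [weightHom, aeval_monomial]
  simp only [mul_pow, Finsupp.prod_mul, ← pow_mul, ← Polynomial.C_pow]
  rw [Finsupp.prod, Finsupp.prod, ← map_prod, Finset.prod_pow_eq_pow_sum,
    monomial_eq (s := δ) (a := c), Finsupp.weight_apply, Finsupp.sum, Finsupp.prod]
  simp only [smul_eq_mul, mul_comm (w _)]
  rw [← Polynomial.C_mul_X_pow_eq_monomial, map_mul, mul_assoc]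
  rfl

theorem coeff_coeff_weightHom (w : σ → ℕ) (p : MvPolynomial σ K) (n : ℕ) (δ : σ →₀ ℕ) :
    ((weightHom w p).coeff n).coeff δ = if Finsupp.weight w δ = n then p.coeff δ else 0 := by
  classical
  induction p using MvPolynomial.induction_on' with
  | monomial ε c =>
    rw [weightHom_monomial, Polynomial.coeff_monomial, coeff_monomial]
    by_cases h : ε = δ
    · subst h
      rw [if_pos rfl]
      split_ifs <;> simp
    · simp only [h, if_false, ite_self]
      split_ifs <;> simp [coeff_monomial, h]
  | add p q hp hq => simp only [map_add, Polynomial.coeff_add, coeff_add, hp, hq]; split_ifs <;> simp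

theorem weightHom_ne_zero (w : σ → ℕ) {p : MvPolynomial σ K} (hp : p ≠ 0) : weightHom w p ≠ 0 := by
  obtain ⟨δ, hδ⟩ := ne_zero_iff.mp hp
  intro h
  have := coeff_coeff_weightHom w p (Finsupp.weight w δ) δ
  simp only [h, Polynomial.coeff_zero, coeff_zero, if_true] at this
  exact hδ this.symm

/-- Homogeneity says that the image under `weightHom` involves a single power of T. Degree and
trailing degree are both additive over a domain, so if they agree for a product they agree for each
factor. -/
theorem IsWeightedHomogeneous.exists_left_nat {w : σ → ℕ} {G H : MvPolynomial σ K} {m : ℕ}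
    (h : IsWeightedHomogeneous w (G * H) m) (hGH : G * H ≠ 0) :
    ∃ m₁, IsWeightedHomogeneous w G m₁ := by
  have hG := weightHom_ne_zero w (left_ne_zero_of_mul hGH)
  have hH := weightHom_ne_zero w (right_ne_zero_of_mul hGH)
  have hcoeff : ∀ n, n ≠ m → (weightHom w (G * H)).coeff n = 0 := by
    intro n hn
    ext δ
    rw [coeff_coeff_weightHom, coeff_zero]
    split_ifs with hδ
    · exact h.coeff_eq_zero δ (by omega)
    · rfl
  have hne := weightHom_ne_zero w hGH
  have h1 : (weightHom w (G * H)).natDegree = m := by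
    by_contra hc
    exact hne (Polynomial.leadingCoeff_eq_zero.mp (hcoeff _ hc))
  have h2 : (weightHom w (G * H)).natTrailingDegree = m := by
    by_contra hc
    exact hne (Polynomial.trailingCoeff_eq_zero.mp (hcoeff _ hc))
  rw [map_mul] at h1 h2
  rw [Polynomial.natDegree_mul hG hH] at h1
  rw [Polynomial.natTrailingDegree_mul hG hH] at h2
  have h3 := Polynomial.natTrailingDegree_le_natDegree (weightHom w G)
  have h4 := Polynomial.natTrailingDegree_le_natDegree (weightHom w H)
  refine ⟨(weightHom w G).natDegree, fun δ hδ => ?_⟩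
  have h5 := coeff_coeff_weightHom w G (Finsupp.weight w δ) δ
  rw [if_pos rfl] at h5
  have h6 : (weightHom w G).coeff (Finsupp.weight w δ) ≠ 0 := by
    intro h0
    rw [h0, coeff_zero] at h5
    exact hδ h5.symm
  have h7 := Polynomial.le_natDegree_of_ne_zero h6
  have h8 := Polynomial.natTrailingDegree_le_of_ne_zero h6
  omega

theorem weight_apply_apply (w : σ → ι → ℕ) (δ : σ →₀ ℕ) (j : ι) :
    Finsupp.weight w δ j = Finsupp.weight (fun i => w i j) δ := by
  simp [Finsupp.weight_apply, Finsupp.sum]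

/-- Factors of a weighted homogeneous polynomial are weighted homogeneous. -/
theorem IsWeightedHomogeneous.exists_left {w : σ → ι → ℕ} {G H : MvPolynomial σ K} {m : ι → ℕ}
    (h : IsWeightedHomogeneous w (G * H) m) (hGH : G * H ≠ 0) :
    ∃ m₁, IsWeightedHomogeneous w G m₁ := by
  have : ∀ j, ∃ m₁, IsWeightedHomogeneous (fun i => w i j) G m₁ := fun j =>
    IsWeightedHomogeneous.exists_left_nat (m := m j) (H := H)
      (fun δ hδ => by rw [← weight_apply_apply, h hδ]) hGH
  choose m₁ hm₁ using this
  exact ⟨m₁, fun δ hδ => funext fun j => by rw [weight_apply_apply, hm₁ j hδ]⟩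

end Homogeneous

/-! ### The weights orthogonal to a primitive direction and their homogeneous polynomials. -/

section Rays

variable {σ K : Type*} [Fintype σ] [Field K]

/-- The exponents `a` and `b` are the positive and the negative part of a primitive lattice vector
having coordinates of both signs. -/
structure IsPrimitivePair (a b : σ →₀ ℕ) : Prop where
  disjoint : ∀ i, a i = 0 ∨ b i = 0
  left_ne_zero : a ≠ 0
  right_ne_zero : b ≠ 0
  exists_bezout : ∃ e : σ → ℤ, ∑ i, e i * ((a i : ℤ) - b i) = 1

theorem IsPrimitivePair.symm {a b : σ →₀ ℕ} (h : IsPrimitivePair a b) : IsPrimitivePair b a where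
  disjoint i := (h.disjoint i).symm
  left_ne_zero := h.right_ne_zero
  right_ne_zero := h.left_ne_zero
  exists_bezout := by
    obtain ⟨e, he⟩ := h.exists_bezout
    refine ⟨-e, ?_⟩
    rw [← he]
    refine Finset.sum_congr rfl fun i _ => ?_
    simp only [Pi.neg_apply]
    ring

theorem IsPrimitivePair.exists_left {a b : σ →₀ ℕ} (h : IsPrimitivePair a b) :
    ∃ i, 0 < a i ∧ b i = 0 := by
  obtain ⟨i, hi⟩ := Finsupp.ne_iff.mp h.left_ne_zero
  rw [Finsupp.zero_apply] at hi
  exact ⟨i, Nat.pos_of_ne_zero hi, (h.disjoint i).resolve_left hi⟩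

theorem IsPrimitivePair.exists_right {a b : σ →₀ ℕ} (h : IsPrimitivePair a b) :
    ∃ i, 0 < b i ∧ a i = 0 := h.symm.exists_left

open Classical in
/-- The extremal rays of the cone of nonnegative vectors orthogonal to `a - b`, as a family of
weights on the variables. -/
noncomputable def rayWeight (a b : σ →₀ ℕ) (i : σ) : (σ × σ) ⊕ σ → ℕ
  | .inl (r, s) => if 0 < a r ∧ 0 < b s then
      (if i = r then b s else 0) + (if i = s then a r else 0) else 0
  | .inr r => if a r = 0 ∧ b r = 0 ∧ i = r then 1 else 0

theorem weight_rayWeight_inl (a b δ : σ →₀ ℕ) (r s : σ) :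
    Finsupp.weight (rayWeight a b) δ (.inl (r, s)) =
      if 0 < a r ∧ 0 < b s then b s * δ r + a r * δ s else 0 := by
  classical
  simp only [Finsupp.weight_eq_sum, Finset.sum_apply, Pi.smul_apply, rayWeight, smul_eq_mul]
  split_ifs
  · simp [mul_add, Finset.sum_add_distrib, mul_comm]
  · simp

theorem weight_rayWeight_inr (a b δ : σ →₀ ℕ) (r : σ) :
    Finsupp.weight (rayWeight a b) δ (.inr r) = if a r = 0 ∧ b r = 0 then δ r else 0 := by
  classical
  simp only [Finsupp.weight_eq_sum, Finset.sum_apply, Pi.smul_apply, rayWeight, smul_eq_mul]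
  by_cases h : a r = 0 ∧ b r = 0
  · simp [h]
  · rw [if_neg h]
    refine Finset.sum_eq_zero fun i _ => ?_
    rw [if_neg (by tauto), mul_zero]

theorem weight_rayWeight_le_iff {a b δ ε : σ →₀ ℕ} :
    Finsupp.weight (rayWeight a b) δ ≤ Finsupp.weight (rayWeight a b) ε ↔
      (∀ r s, 0 < a r → 0 < b s → b s * δ r + a r * δ s ≤ b s * ε r + a r * ε s) ∧
        ∀ r, a r = 0 → b r = 0 → δ r ≤ ε r := by
  rw [Pi.le_def, Sum.forall, Prod.forall]
  simp only [weight_rayWeight_inl, weight_rayWeight_inr]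
  refine and_congr (forall₂_congr fun r s => ?_) (forall_congr' fun r => ?_)
  · split_ifs <;> simp_all
  · split_ifs <;> simp_all

/-- A coordinate in one support is paired with some coordinate of the other, which is nonempty; a
coordinate outside both has a ray of its own. -/
theorem rayWeight_ne_zero {a b : σ →₀ ℕ} (h : IsPrimitivePair a b) (i : σ) :
    rayWeight a b i ≠ 0 := by
  classical
  intro h0
  by_cases ha : a i = 0
  · by_cases hb : b i = 0
    · simpa [rayWeight, ha, hb] using congrFun h0 (.inr i)
    · obtain ⟨r, hr, -⟩ := h.exists_left
      have := congrFun h0 (.inl (r, i))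
      simp [rayWeight, hr, Nat.pos_of_ne_zero hb] at this
      omega
  · obtain ⟨s, hs, -⟩ := h.exists_right
    have := congrFun h0 (.inl (i, s))
    simp [rayWeight, hs, Nat.pos_of_ne_zero ha] at this
    omega

theorem weight_rayWeight_left_eq_right {a b : σ →₀ ℕ} (h : IsPrimitivePair a b) :
    Finsupp.weight (rayWeight a b) a = Finsupp.weight (rayWeight a b) b := by
  refine le_antisymm (weight_rayWeight_le_iff.mpr ⟨fun r s hr hs => ?_, fun r h1 h2 => by omega⟩)
    (weight_rayWeight_le_iff.mpr ⟨fun r s hr hs => ?_, fun r h1 h2 => by omega⟩)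
  all_goals
    rw [(h.disjoint r).resolve_left hr.ne', (h.disjoint s).resolve_right hs.ne']
    rw [mul_comm]; simp [mul_comm]

/-- Exponents of the same weights differ by an integral multiple of `a - b`. -/
theorem exists_eq_mul_of_weight_eq {a b : σ →₀ ℕ} (h : IsPrimitivePair a b) {δ ε : σ →₀ ℕ}
    (hδ : Finsupp.weight (rayWeight a b) δ = Finsupp.weight (rayWeight a b) ε) :
    ∃ j : ℤ, ∀ i, (δ i : ℤ) - ε i = j * ((a i : ℤ) - b i) := by
  have h1 := weight_rayWeight_le_iff.mp hδ.le
  have h2 := weight_rayWeight_le_iff.mp hδ.ge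
  obtain ⟨d, hd⟩ : ∃ d : σ → ℤ, ∀ i, d i = (δ i : ℤ) - ε i := ⟨_, fun _ => rfl⟩
  have e1 : ∀ r s, 0 < a r → 0 < b s → (b s : ℤ) * d r + a r * d s = 0 := by
    intro r s hr hs
    have := le_antisymm (h1.1 r s hr hs) (h2.1 r s hr hs)
    rw [hd, hd]
    zify at this
    linear_combination this
  have e2 : ∀ r, a r = 0 → b r = 0 → d r = 0 := by
    intro r hr hs
    have := le_antisymm (h1.2 r hr hs) (h2.2 r hr hs)
    rw [hd, this, sub_self]
  obtain ⟨r₀, hr₀, hr₀'⟩ := h.exists_left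
  obtain ⟨s₀, hs₀, hs₀'⟩ := h.exists_right
  -- Orthogonality to the rays makes d proportional to a - b over the rationals; the Bézout relation
  -- for a - b then makes the factor an integer.
  have key : ∀ i, d i * a r₀ = d r₀ * ((a i : ℤ) - b i) := by
    intro i
    by_cases ha : a i = 0
    · by_cases hb : b i = 0
      · simp [e2 i ha hb, ha, hb]
      · have := e1 r₀ i hr₀ (Nat.pos_of_ne_zero hb)
        rw [ha]; push_cast; linear_combination this
    · have hb := (h.disjoint i).resolve_left ha
      have t1 := e1 i s₀ (Nat.pos_of_ne_zero ha) hs₀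
      have t2 := e1 r₀ s₀ hr₀ hs₀
      rw [hb]
      have hne : (b s₀ : ℤ) ≠ 0 := by exact_mod_cast hs₀.ne'
      apply mul_left_cancel₀ hne
      push_cast
      linear_combination (a r₀ : ℤ) * t1 - (a i : ℤ) * t2
  obtain ⟨e, he⟩ := h.exists_bezout
  refine ⟨∑ i, e i * d i, fun i => ?_⟩
  rw [← hd]
  have hne : (a r₀ : ℤ) ≠ 0 := by exact_mod_cast hr₀.ne'
  apply mul_right_cancel₀ hne
  rw [key i]
  have : (∑ i, e i * d i) * a r₀ = d r₀ := by
    rw [Finset.sum_mul]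
    calc ∑ i, e i * d i * a r₀ = ∑ i, d r₀ * (e i * ((a i : ℤ) - b i)) :=
          Finset.sum_congr rfl fun i _ => by rw [mul_assoc, key i]; ring
      _ = d r₀ := by rw [← Finset.mul_sum, he, mul_one]
  linear_combination -((a i : ℤ) - b i) * this

theorem isWeightedHomogeneous_binaryForm {a b : σ →₀ ℕ} (h : IsPrimitivePair a b) (d : ℕ)
    (φ : Polynomial K) :
    IsWeightedHomogeneous (rayWeight a b) (binaryForm a b d φ)
      (d • Finsupp.weight (rayWeight a b) a) := by
  rw [binaryForm_eq_sum]
  refine IsWeightedHomogeneous.sum _ _ _ fun i hi => isWeightedHomogeneous_monomial _ _ _ ?_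
  rw [map_add, map_nsmul, map_nsmul, ← weight_rayWeight_left_eq_right h, ← add_nsmul]
  congr 1
  have := Finset.mem_range.mp hi
  omega

/-- A coordinate where a is positive and b vanishes reads off i, so the truncated subtractions play
no role. -/
theorem binaryExponent_injective {a b : σ →₀ ℕ} (h : IsPrimitivePair a b) {d i d' j : ℕ}
    (hij : i • a + (d - i) • b = j • a + (d' - j) • b) : i = j := by
  obtain ⟨r, hr, hr'⟩ := h.exists_left
  have := DFunLike.congr_fun hij r
  simp [hr'] at this
  omega

theorem coeff_binaryForm {a b : σ →₀ ℕ} (h : IsPrimitivePair a b) {d i : ℕ} (hi : i ≤ d)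
    (φ : Polynomial K) :
    (binaryForm a b d φ).coeff (i • a + (d - i) • b) = φ.coeff i := by
  classical
  rw [binaryForm_eq_sum, coeff_sum, Finset.sum_eq_single i]
  · simp
  · intro j _ hj
    rw [coeff_monomial, if_neg fun hc => hj (binaryExponent_injective h hc)]
  · intro hc
    exact absurd (Finset.mem_range.mpr (by omega)) hc

/-- The normal form of a nonzero polynomial supported on a line parallel to `a - b`. -/
theorem exists_eq_monomial_mul_binaryForm {a b : σ →₀ ℕ} (h : IsPrimitivePair a b)
    {p : MvPolynomial σ K} (hp0 : p ≠ 0) {m : (σ × σ) ⊕ σ → ℕ}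
    (hp : IsWeightedHomogeneous (rayWeight a b) p m) :
    ∃ (γ : σ →₀ ℕ) (φ : Polynomial K), φ.coeff 0 ≠ 0 ∧
      p = monomial γ 1 * binaryForm a b φ.natDegree φ := by
  classical
  obtain ⟨e, he⟩ := h.exists_bezout
  -- L has value 1 on a - b, so it is an integral coordinate on the line carrying the support; δ₀
  -- and δ₁ are the two ends.
  let L : (σ →₀ ℕ) → ℤ := fun δ => ∑ i, e i * δ i
  have hne : p.support.Nonempty := support_nonempty.mpr hp0
  obtain ⟨δ₀, hδ₀, hmin⟩ := Finset.exists_min_image p.support L hne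
  obtain ⟨δ₁, hδ₁, hmax⟩ := Finset.exists_max_image p.support L hne
  have hline : ∀ δ ∈ p.support, ∀ i, (δ i : ℤ) - δ₀ i = (L δ - L δ₀) * ((a i : ℤ) - b i) := by
    intro δ hδ
    obtain ⟨j, hj⟩ := exists_eq_mul_of_weight_eq h
      ((hp (mem_support_iff.mp hδ)).trans (hp (mem_support_iff.mp hδ₀)).symm)
    have : L δ - L δ₀ = j := by
      simp only [L]
      rw [← Finset.sum_sub_distrib]
      calc ∑ i, (e i * δ i - e i * δ₀ i) = ∑ i, j * (e i * ((a i : ℤ) - b i)) :=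
            Finset.sum_congr rfl fun i _ => by rw [← mul_sub, hj i]; ring
        _ = j := by rw [← Finset.mul_sum, he, mul_one]
    rw [this]
    exact hj
  obtain ⟨d, hd⟩ := Int.eq_ofNat_of_zero_le (sub_nonneg.mpr (hmin δ₁ hδ₁))
  -- On the support of b the end δ₁ = δ₀ + d (a - b) equals δ₀ - d b, and it is nonnegative.
  have hdb : d • b ≤ δ₀ := by
    intro i
    have h1 := hline δ₁ hδ₁ i
    rw [hd] at h1
    simp only [Finsupp.smul_apply, smul_eq_mul]
    rcases h.disjoint i with ha | hb
    · rw [ha] at h1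
      zify
      push_cast at h1
      linarith [Int.natCast_nonneg (δ₁ i)]
    · simp [hb]
  obtain ⟨γ, hγ⟩ := exists_add_of_le hdb
  have hexp : ∀ δ ∈ p.support, ∃ j ≤ d, δ = γ + (j • a + (d - j) • b) := by
    intro δ hδ
    obtain ⟨j, hj⟩ := Int.eq_ofNat_of_zero_le (sub_nonneg.mpr (hmin δ hδ))
    have hjd : j ≤ d := by
      have := hmax δ hδ
      zify
      rw [← hd, ← hj]; linarith
    refine ⟨j, hjd, Finsupp.ext fun i => ?_⟩
    have h1 := hline δ hδ i
    rw [hj, hγ] at h1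
    simp only [Finsupp.add_apply, Finsupp.smul_apply, smul_eq_mul] at h1 ⊢
    zify [hjd]
    push_cast at h1
    linear_combination h1
  let c : ℕ → K := fun j => p.coeff (γ + (j • a + (d - j) • b))
  let φ : Polynomial K := ∑ j ∈ Finset.range (d + 1), Polynomial.monomial j (c j)
  have hφ : ∀ j, φ.coeff j = if j ≤ d then c j else 0 := by
    intro j
    simp only [φ, Polynomial.finsetSum_coeff, Polynomial.coeff_monomial]
    rw [Finset.sum_ite_eq']
    simp
  have hL : ∀ j ≤ d, L (γ + (j • a + (d - j) • b)) = L δ₀ + j := by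
    intro j hj
    simp only [L]
    rw [← sub_eq_iff_eq_add', ← Finset.sum_sub_distrib]
    calc ∑ i, (e i * ((γ + (j • a + (d - j) • b)) i : ℕ) - e i * δ₀ i)
        = ∑ i, (j : ℤ) * (e i * ((a i : ℤ) - b i)) := Finset.sum_congr rfl fun i _ => by
          rw [hγ]
          simp only [Finsupp.add_apply, Finsupp.smul_apply, smul_eq_mul]
          push_cast [hj]
          ring
      _ = j := by rw [← Finset.mul_sum, he, mul_one]
  have hc0 : c 0 ≠ 0 := by
    simp only [c, zero_smul, zero_add, Nat.sub_zero]
    rw [add_comm, ← hγ]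
    exact mem_support_iff.mp hδ₀
  have hcd : c d ≠ 0 := by
    obtain ⟨j, hj, hδj⟩ := hexp δ₁ hδ₁
    have := hL j hj
    rw [← hδj, ← sub_eq_iff_eq_add', hd] at this
    have hjd : j = d := by exact_mod_cast this.symm
    subst hjd
    simp only [c]
    rw [← hδj]
    exact mem_support_iff.mp hδ₁
  have hdeg : φ.natDegree = d := by
    refine le_antisymm (Polynomial.natDegree_le_iff_coeff_eq_zero.mpr fun j hj => ?_)
      (Polynomial.le_natDegree_of_ne_zero ?_)
    · rw [hφ, if_neg (by omega)]
    · rwa [hφ, if_pos le_rfl]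
  refine ⟨γ, φ, by rwa [hφ, if_pos (Nat.zero_le _)], ?_⟩
  rw [binaryForm_eq_sum, hdeg, Finset.mul_sum]
  simp only [monomial_mul, one_mul]
  ext δ
  rw [coeff_sum]
  by_cases hδ : δ ∈ p.support
  · obtain ⟨j, hj, rfl⟩ := hexp δ hδ
    rw [Finset.sum_eq_single j]
    · rw [coeff_monomial, if_pos rfl, hφ, if_pos hj]
    · intro i _ hij
      rw [coeff_monomial, if_neg fun hc => hij (binaryExponent_injective h (add_left_cancel hc))]
    · intro hc
      exact absurd (Finset.mem_range.mpr (by omega)) hc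
  · rw [notMem_support_iff.mp hδ]
    refine (Finset.sum_eq_zero fun j hj => ?_).symm
    rw [coeff_monomial]
    split_ifs with hc
    · rw [hφ, if_pos (by have := Finset.mem_range.mp hj; omega)]
      simp only [c]
      rw [hc]
      exact notMem_support_iff.mp hδ
    · rfl

/-- A binary form is determined by its value at `X^a` and `X^b`, together with a monomial factor. -/
theorem eq_of_binaryForm_eq_monomial_mul {a b : σ →₀ ℕ} (h : IsPrimitivePair a b)
    {φ ψ : Polynomial K} {γ : σ →₀ ℕ} (hφ : φ.coeff 0 ≠ 0)
    (heq : binaryForm a b φ.natDegree φ = monomial γ 1 * binaryForm a b ψ.natDegree ψ) :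
    γ = 0 ∧ φ = ψ := by
  classical
  have hφ0 : φ ≠ 0 := by rintro rfl; simp at hφ
  have hexp : ∀ i ≤ φ.natDegree, φ.coeff i ≠ 0 → ∃ j ≤ ψ.natDegree,
      i • a + (φ.natDegree - i) • b = γ + (j • a + (ψ.natDegree - j) • b) := by
    intro i hi hc
    have h1 := coeff_binaryForm h hi φ
    rw [heq, binaryForm_eq_sum, Finset.mul_sum, coeff_sum] at h1
    obtain ⟨j, hj, hj'⟩ := Finset.exists_ne_zero_of_sum_ne_zero (h1.trans_ne hc)
    rw [monomial_mul, coeff_monomial] at hj'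
    refine ⟨j, by have := Finset.mem_range.mp hj; omega, ?_⟩
    by_contra hne
    exact hj' (if_neg (Ne.symm hne))
  obtain ⟨i, hi, hi'⟩ := hexp 0 (Nat.zero_le _) hφ
  obtain ⟨j, hj, hj'⟩ := hexp φ.natDegree le_rfl (by simpa using hφ0)
  -- With d the degree of φ, the exponents d b and d a both occur on the left, so γ lies below both;
  -- their supports are disjoint.
  have hγ : γ = 0 := by
    ext r
    have h1 := DFunLike.congr_fun hi' r
    have h2 := DFunLike.congr_fun hj' r
    simp only [Finsupp.add_apply, Finsupp.smul_apply, smul_eq_mul, Nat.sub_self, zero_mul,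
      add_zero, Finsupp.zero_apply, zero_add] at h1 h2 ⊢
    rcases h.disjoint r with hr | hr <;> rw [hr] at h1 h2 <;> simp at h1 h2 <;> omega
  subst hγ
  rw [zero_add] at hj' hi'
  have hd : φ.natDegree = ψ.natDegree := by
    have := binaryExponent_injective h hj'
    subst this
    obtain ⟨r, hr, hr'⟩ := h.exists_right
    have := DFunLike.congr_fun hj' r
    simp [hr'] at this
    omega
  refine ⟨rfl, Polynomial.ext fun i => ?_⟩
  by_cases hi : i ≤ φ.natDegree
  · rw [← coeff_binaryForm h hi φ, heq, hd, ← coeff_binaryForm h (hd ▸ hi) ψ]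
    simp [monomial_zero']
  · rw [Polynomial.coeff_eq_zero_of_natDegree_lt (by omega),
      Polynomial.coeff_eq_zero_of_natDegree_lt (by omega)]

/-- The binary form of an irreducible polynomial other than the variable is irreducible at the
monomials given by a primitive pair of exponents. -/
theorem irreducible_binaryForm {a b : σ →₀ ℕ} (h : IsPrimitivePair a b) {ψ : Polynomial K}
    (hψ : Irreducible ψ) (hψ0 : ψ.coeff 0 ≠ 0) :
    Irreducible (binaryForm a b ψ.natDegree ψ) := by
  have hne : binaryForm a b ψ.natDegree ψ ≠ 0 := by
    intro h0
    have := coeff_binaryForm h (Nat.zero_le ψ.natDegree) ψ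
    rw [h0, coeff_zero] at this
    exact hψ0 this.symm
  have hunit : ∀ {φ : Polynomial K}, IsUnit φ → IsUnit (binaryForm a b φ.natDegree φ) := by
    intro φ hφ
    obtain ⟨c, hc, rfl⟩ := Polynomial.isUnit_iff.mp hφ
    rw [Polynomial.natDegree_C, binaryForm_C]
    exact hc.map C
  constructor
  · intro hu
    obtain ⟨c, -, hc⟩ := (isUnit_iff_eq_C_of_isReduced).mp hu
    have h1 : binaryForm a b ψ.natDegree ψ =
        monomial 0 1 * binaryForm a b (Polynomial.C c).natDegree (Polynomial.C c) := by
      rw [Polynomial.natDegree_C, binaryForm_C, hc, monomial_zero', C_1, one_mul]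
    have h2 := (eq_of_binaryForm_eq_monomial_mul h hψ0 h1).2
    exact hψ.natDegree_pos.ne' (by rw [h2, Polynomial.natDegree_C])
  · intro G H hGH
    have hhom := isWeightedHomogeneous_binaryForm h ψ.natDegree ψ
    have hne' := hne
    rw [hGH] at hhom hne'
    -- Both factors inherit homogeneity for the ray weights, hence a normal form; uniqueness of the
    -- normal form turns their product into a factorization of ψ itself.
    obtain ⟨m₁, h₁⟩ := IsWeightedHomogeneous.exists_left hhom hne'
    rw [mul_comm] at hhom
    obtain ⟨m₂, h₂⟩ := IsWeightedHomogeneous.exists_left hhom (by rwa [mul_comm])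
    obtain ⟨γ₁, g, hg, rfl⟩ := exists_eq_monomial_mul_binaryForm h (left_ne_zero_of_mul hne') h₁
    obtain ⟨γ₂, k, hk, rfl⟩ := exists_eq_monomial_mul_binaryForm h (right_ne_zero_of_mul hne') h₂
    have hg0 : g ≠ 0 := by rintro rfl; simp at hg
    have hk0 : k ≠ 0 := by rintro rfl; simp at hk
    have h4 : (monomial (γ₁ + γ₂) (1 : K)) = monomial γ₁ 1 * monomial γ₂ 1 := by
      rw [monomial_mul, one_mul]
    have h3 : binaryForm a b ψ.natDegree ψ =
        monomial (γ₁ + γ₂) 1 * binaryForm a b (g * k).natDegree (g * k) := by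
      rw [hGH, Polynomial.natDegree_mul hg0 hk0, binaryForm_mul a b le_rfl le_rfl, h4]
      ring
    obtain ⟨hγ, hgk⟩ := eq_of_binaryForm_eq_monomial_mul h hψ0 h3
    obtain ⟨rfl, rfl⟩ := add_eq_zero.mp hγ
    rw [monomial_zero', C_1, one_mul, one_mul]
    exact (hψ.isUnit_or_isUnit hgk).imp hunit hunit

end Rays

end LooseEdge

namespace LooseEdge

open MvPolynomial

/-! ### Monomials of large weight lie in the ideal of a coprime pair. -/

section Membership

variable {σ K : Type*} [Fintype σ] [Field K]

/-- The largest multiple of `a` fitting below `d` on the support of `a`. -/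
theorem exists_max_multiple {a : σ →₀ ℕ} (ha : ∃ i, 0 < a i) (d : σ → ℤ) :
    ∃ m : ℤ, (∀ i, 0 < a i → m * a i ≤ d i) ∧ ∃ i, 0 < a i ∧ d i < (m + 1) * a i := by
  classical
  obtain ⟨i₀, hi₀⟩ := ha
  obtain ⟨i, hi, hmin⟩ := Finset.exists_min_image (Finset.univ.filter fun i => 0 < a i)
    (fun i => d i / a i) ⟨i₀, by simpa using hi₀⟩
  have hpos : ∀ {i}, 0 < a i → (0 : ℤ) < a i := fun h => by exact_mod_cast h
  simp only [Finset.mem_filter, Finset.mem_univ, true_and] at hi hmin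
  refine ⟨d i / a i, fun j hj => ?_, i, hi, Int.lt_ediv_add_one_mul_self _ (hpos hi)⟩
  exact (Int.le_ediv_iff_mul_le (hpos hj)).mp (hmin j hj)

/-- Every monomial of weight at least that of `X^(γ₁ + γ₂ + k a)` lies in the ideal generated by two
coprime binary forms of total degree `k`, multiplied by `X^γ₁` and `X^γ₂`. -/
theorem monomial_mem_span_of_weight_le {a b : σ →₀ ℕ} (hab : IsPrimitivePair a b)
    {g h : Polynomial K} (hgh : IsCoprime g h) (hg : g ≠ 0) (hh : h.coeff 0 ≠ 0)
    (hk : 1 ≤ g.natDegree + h.natDegree) {δ γ₁ γ₂ : σ →₀ ℕ} (h₁ : ∀ i, γ₁ i ≠ 0 → 0 < a i)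
    (h₂ : ∀ i, γ₂ i ≠ 0 → 0 < b i)
    (hδ : Finsupp.weight (rayWeight a b) (γ₁ + γ₂ + (g.natDegree + h.natDegree) • a) ≤
      Finsupp.weight (rayWeight a b) δ) :
    monomial δ (1 : K) ∈ Ideal.span {monomial γ₁ 1 * binaryForm a b g.natDegree g,
      monomial γ₂ 1 * binaryForm a b h.natDegree h} := by
  set k := g.natDegree + h.natDegree with hk_def
  obtain ⟨M, hM, i, hi, hMi⟩ := exists_max_multiple (a := a)
    (hab.exists_left.imp fun _ h => h.1) (fun i => (δ i : ℤ) - γ₁ i)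
  obtain ⟨L, hL, j, hj, hLj⟩ := exists_max_multiple (a := b)
    (hab.exists_right.imp fun _ h => h.1) (fun i => (δ i : ℤ) - γ₂ i)
  have ha0 : ∀ {i}, 0 < b i → a i = 0 ∧ γ₁ i = 0 := fun {i} hi => by
    have h0 : a i = 0 := (hab.disjoint i).resolve_right hi.ne'
    refine ⟨h0, ?_⟩
    by_contra hc
    exact (h₁ i hc).ne' h0
  have hb0 : ∀ {i}, 0 < a i → b i = 0 ∧ γ₂ i = 0 := fun {i} hi => by
    have h0 : b i = 0 := (hab.disjoint i).resolve_left hi.ne'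
    refine ⟨h0, ?_⟩
    by_contra hc
    exact (h₂ i hc).ne' h0
  -- The ray of the pair i, j at which M and L cannot be increased bounds k strictly by (M + 1) + (L
  -- + 1).
  have hML : (k : ℤ) < M + L + 2 := by
    have h3 := (weight_rayWeight_le_iff.mp hδ).1 i j hi hj
    simp only [Finsupp.add_apply, Finsupp.smul_apply, smul_eq_mul, (ha0 hj).1, (ha0 hj).2,
      (hb0 hi).2, add_zero, mul_zero, zero_add] at h3
    have hai : (0 : ℤ) < a i := by exact_mod_cast hi
    have hbj : (0 : ℤ) < b j := by exact_mod_cast hj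
    zify at h3
    by_contra hc
    push Not at hc
    have e1 := mul_lt_mul_of_pos_left hMi hbj
    have e2 := mul_lt_mul_of_pos_left hLj hai
    have e3 := mul_le_mul_of_nonneg_left hc (mul_pos hai hbj).le
    nlinarith
  -- The criterion needs m + l = k - 1 + r + s with m - r ≤ M and l - s ≤ L, and k - 1 ≤ M + L is
  -- exactly the room required. Since k ≥ 1, at most one of M, L is negative; r or s makes up for
  -- it.
  obtain ⟨m, l, r, s, hsum, hm, hl, hmr, hls⟩ : ∃ m l r s : ℕ, m + l + 1 = k + r + s ∧
      (m : ℤ) ≤ M + r ∧ (l : ℤ) ≤ L + s ∧ (m = 0 ∨ r = 0) ∧ (l = 0 ∨ s = 0) := by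
    rcases lt_or_ge M 0 with hM0 | hM0
    · exact ⟨0, k - 1 + (-M).toNat, (-M).toNat, 0, by omega, by omega, by omega, by omega, by omega⟩
    · rcases lt_or_ge L 0 with hL0 | hL0
      · exact ⟨k - 1 + (-L).toNat, 0, 0, (-L).toNat, by omega, by omega, by omega, by omega,
          by omega⟩
      · exact ⟨min M.toNat (k - 1), k - 1 - min M.toNat (k - 1), 0, 0, by omega, by omega, by omega,
          by omega, by omega⟩
  have hMa : ∀ {i}, 0 < a i → (γ₁ i : ℤ) + m * a i ≤ δ i + r * a i := fun {i} hi => by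
    have e1 := hM i hi
    have e2 := mul_le_mul_of_nonneg_right hm (Int.natCast_nonneg (a i))
    linarith
  have hLb : ∀ {i}, 0 < b i → (γ₂ i : ℤ) + l * b i ≤ δ i + s * b i := fun {i} hi => by
    have e1 := hL i hi
    have e2 := mul_le_mul_of_nonneg_right hl (Int.natCast_nonneg (b i))
    linarith
  have hma : ∀ {i}, 0 < a i → m * a i ≤ δ i := fun {i} hi => by
    rcases hmr with h0 | h0
    · simp [h0]
    · have := hMa hi
      rw [h0] at this
      zify
      push_cast at this
      linarith [Int.natCast_nonneg (γ₁ i)]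
  have hlb : ∀ {i}, 0 < b i → l * b i ≤ δ i := fun {i} hi => by
    rcases hls with h0 | h0
    · simp [h0]
    · have := hLb hi
      rw [h0] at this
      zify
      push_cast at this
      linarith [Int.natCast_nonneg (γ₂ i)]
  have hsplit : ∀ i, (0 < a i ∧ b i = 0 ∧ γ₂ i = 0) ∨ (0 < b i ∧ a i = 0 ∧ γ₁ i = 0) ∨
      (a i = 0 ∧ b i = 0 ∧ γ₁ i = 0 ∧ γ₂ i = 0) := fun i => by
    rcases Nat.eq_zero_or_pos (a i) with ha | ha
    · rcases Nat.eq_zero_or_pos (b i) with hb | hb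
      · refine .inr (.inr ⟨ha, hb, ?_, ?_⟩)
        · by_contra hc; exact (h₁ i hc).ne' ha
        · by_contra hc; exact (h₂ i hc).ne' hb
      · exact .inr (.inl ⟨hb, ha0 hb⟩)
    · exact .inl ⟨ha, hb0 ha⟩
  refine monomial_mem_span_of_le hgh hg hh hsum (fun i => ?_) (fun i => ?_) (fun i => ?_)
  all_goals
    simp only [Finsupp.add_apply, Finsupp.smul_apply, smul_eq_mul]
    rcases hsplit i with ⟨hi, e1, e2⟩ | ⟨hi, e1, e2⟩ | ⟨e1, e2, e3, e4⟩
  · rw [e1]; simpa using hma hi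
  · rw [e1]; simpa using hlb hi
  · simp [e1, e2]
  · rw [e1]; zify; simpa using hMa hi
  · rw [e1, e2]; simpa using hlb hi
  · simp [e1, e2, e3]
  · rw [e1, e2]; simpa using hma hi
  · rw [e1]; zify; simpa using hLb hi
  · simp [e1, e2, e4]

theorem isWeightedHomogeneous_monomial_mul_binaryForm {a b : σ →₀ ℕ} (hab : IsPrimitivePair a b)
    (γ : σ →₀ ℕ) (φ : Polynomial K) :
    IsWeightedHomogeneous (rayWeight a b) (monomial γ 1 * binaryForm a b φ.natDegree φ)
      (Finsupp.weight (rayWeight a b) (γ + φ.natDegree • a)) := by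
  rw [map_add, map_nsmul]
  exact (isWeightedHomogeneous_monomial _ _ _ rfl).mul (isWeightedHomogeneous_binaryForm hab _ _)

end Membership

/-! ### Consequences of irreducibility for the initial form. -/

section Irreducible

theorem eq_zero_of_weight_eq_zero {σ ι : Type*} [Fintype σ] {w : σ → ι → ℕ} (hw : ∀ i, w i ≠ 0)
    {δ : σ →₀ ℕ} (h : Finsupp.weight w δ = 0) : δ = 0 := by
  ext i
  obtain ⟨j, hj⟩ := Function.ne_iff.mp (hw i)
  have := congrFun h j
  rw [Finsupp.weight_eq_sum, Finset.sum_apply, Pi.zero_apply, Finset.sum_eq_zero_iff] at this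
  simpa [show w i j ≠ 0 from hj] using this i (Finset.mem_univ i)

/-- A polynomial without nontrivial coprime factorizations is, up to a constant, a power of an
irreducible polynomial. -/
theorem exists_eq_C_mul_pow {K : Type*} [Field K] {φ : Polynomial K} (hφ : 0 < φ.natDegree)
    (h : ∀ g h, IsCoprime g h → φ = g * h → g.natDegree = 0 ∨ h.natDegree = 0) :
    ∃ (c : K) (ψ : Polynomial K) (m : ℕ), c ≠ 0 ∧ m ≠ 0 ∧ Irreducible ψ ∧
      φ = Polynomial.C c * ψ ^ m := by
  have hφ0 : φ ≠ 0 := by rintro rfl; simp at hφ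
  have hnu : ¬ IsUnit φ := fun hu => hφ.ne' (Polynomial.natDegree_eq_zero_of_isUnit hu)
  obtain ⟨ψ, hψ, hdvd⟩ := WfDvdMonoid.exists_irreducible_factor hnu hφ0
  obtain ⟨q, hq, hφq⟩ :=
    (FiniteMultiplicity.of_not_isUnit hψ.not_isUnit hφ0).exists_eq_pow_mul_and_not_dvd
  set m := multiplicity ψ φ
  have hm : m ≠ 0 := by
    intro h0
    rw [h0, pow_zero, one_mul] at hq
    exact hφq (hq ▸ hdvd)
  have hcop : IsCoprime (ψ ^ m) q := (hψ.coprime_iff_not_dvd.mpr hφq).pow_left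
  rcases h _ _ hcop hq with h0 | h0
  · rw [Polynomial.natDegree_pow] at h0
    exact absurd h0 (mul_ne_zero hm hψ.natDegree_pos.ne')
  · obtain ⟨c, rfl⟩ := Polynomial.natDegree_eq_zero.mp h0
    refine ⟨c, ψ, m, ?_, hm, hψ, by rw [mul_comm]; exact hq⟩
    rintro rfl
    simp [hφ0] at hq

theorem not_isUnit_of_mem {S : Type*} [CommRing S] {I : Ideal S} (hI : I ≠ ⊤) {s : S}
    (hs : s ∈ I) : ¬ IsUnit s :=
  fun hu => hI (Ideal.eq_top_of_isUnit_mem _ hs hu)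

theorem aeval_mem_of_coeff_zero {σ R S : Type*} [CommRing R] [CommRing S] [Algebra R S]
    {I : Ideal S} {y : σ → S} (hy : ∀ i, y i ∈ I)
    {f : MvPolynomial σ R} (hf : f.coeff 0 = 0) : aeval y f ∈ I := by
  rw [f.as_sum, map_sum]
  refine Ideal.sum_mem _ fun δ hδ => ?_
  rw [aeval_monomial]
  refine Ideal.mul_mem_left _ _ (Ideal.pow_le_self ?_ (prod_pow_mem_pow_degree hy δ))
  rw [Ne, Finsupp.degree_eq_zero_iff]
  rintro rfl
  exact mem_support_iff.mp hδ hf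

/-- No variable divides an irreducible element without linear part. -/
theorem exists_coeff_ne_zero_of_irreducible {σ R S : Type*} [CommRing R] [CommRing S]
    [Algebra R S] {I : Ideal S} (hI : I ≠ ⊤) {y : σ → S}
    (hy : ∀ i, y i ∈ I) {f : MvPolynomial σ R} (hirr : Irreducible (aeval y f)) {i : σ}
    (hi : f.coeff (Finsupp.single i 1) = 0) : ∃ δ, f.coeff δ ≠ 0 ∧ δ i = 0 := by
  by_contra hc
  push Not at hc
  obtain ⟨q, rfl⟩ : X i ∣ f := by
    rw [X_dvd_iff_modMonomial_eq_zero]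
    ext δ
    rw [coeff_zero]
    by_cases hδ : Finsupp.single i 1 ≤ δ
    · exact coeff_modMonomial_of_le _ hδ
    · rw [coeff_modMonomial_of_not_le _ hδ]
      by_contra h0
      exact hδ (Finsupp.single_le_iff.mpr (Nat.one_le_iff_ne_zero.mpr (hc δ h0)))
  rw [map_mul, aeval_X] at hirr
  have hq : q.coeff 0 = 0 := by
    rw [← hi]
    have := coeff_X_mul 0 i q
    rw [add_zero] at this
    exact this.symm
  exact (hirr.isUnit_or_isUnit rfl).elim (not_isUnit_of_mem hI (hy i))
    (not_isUnit_of_mem hI (aeval_mem_of_coeff_zero hy hq))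

variable {σ : Type*} [Fintype σ] {R S : Type*} [CommRing R] [IsLocalRing R]
  [CommRing S] [Algebra R S]

open IsLocalRing

/-- A coprime factorization of the initial form of an irreducible element is trivial. -/
theorem trivial_of_irreducible_of_isCoprime
    [IsAdicComplete ((maximalIdeal R).map (algebraMap R S)) S]
    (hI : (maximalIdeal R).map (algebraMap R S) ≠ ⊤) {x : σ → R}
    (hx : Ideal.span (Set.range x) = maximalIdeal R) {a b : σ →₀ ℕ} (hab : IsPrimitivePair a b)
    {f : MvPolynomial σ R} {γ₁ γ₂ : σ →₀ ℕ} {g h : Polynomial (ResidueField R)}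
    (hgh : IsCoprime g h) (hg : g ≠ 0) (hh : h.coeff 0 ≠ 0)
    (hk : 1 ≤ g.natDegree + h.natDegree) (h₁ : ∀ i, γ₁ i ≠ 0 → 0 < a i)
    (h₂ : ∀ i, γ₂ i ≠ 0 → 0 < b i)
    (hf : ∀ δ, f.coeff δ ≠ 0 →
      Finsupp.weight (rayWeight a b) (γ₁ + γ₂ + (g.natDegree + h.natDegree) • a) ≤
        Finsupp.weight (rayWeight a b) δ)
    (hfin : ∀ δ, Finsupp.weight (rayWeight a b) δ =
      Finsupp.weight (rayWeight a b) (γ₁ + γ₂ + (g.natDegree + h.natDegree) • a) →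
      residue R (f.coeff δ) =
        (monomial (γ₁ + γ₂) 1 * binaryForm a b (g.natDegree + h.natDegree) (g * h)).coeff δ)
    (hirr : Irreducible (aeval (fun i => algebraMap R S (x i)) f)) :
    (γ₁ = 0 ∧ g.natDegree = 0) ∨ (γ₂ = 0 ∧ h.natDegree = 0) := by
  have hw := rayWeight_ne_zero hab
  have hsum : Finsupp.weight (rayWeight a b) (γ₁ + g.natDegree • a) +
      Finsupp.weight (rayWeight a b) (γ₂ + h.natDegree • a) =
      Finsupp.weight (rayWeight a b) (γ₁ + γ₂ + (g.natDegree + h.natDegree) • a) := by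
    rw [← map_add]
    congr 1
    rw [add_nsmul]
    abel
  have hprod : monomial (γ₁ + γ₂) 1 * binaryForm a b (g.natDegree + h.natDegree) (g * h) =
      monomial γ₁ 1 * binaryForm a b g.natDegree g *
        (monomial γ₂ 1 * binaryForm a b h.natDegree h) := by
    rw [binaryForm_mul a b le_rfl le_rfl, ← one_mul (1 : ResidueField R), ← monomial_mul, one_mul,
      mul_mul_mul_comm]
  rw [← hsum] at hf hfin
  rw [hprod] at hfin
  obtain ⟨u, v, huv, hu, hv⟩ := exists_lift_factorization (S := S) hx hw
    (isWeightedHomogeneous_monomial_mul_binaryForm hab γ₁ g)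
    (isWeightedHomogeneous_monomial_mul_binaryForm hab γ₂ h) (f := f) (fun δ hδ => by
      rw [hsum] at hδ
      exact monomial_mem_span_of_weight_le hab hgh hg hh hk h₁ h₂ hδ) hf hfin
  have hzero : ∀ {γ : σ →₀ ℕ} {d : ℕ},
      Finsupp.weight (rayWeight a b) (γ + d • a) = 0 → γ = 0 ∧ d = 0 := by
    intro γ d h0
    obtain ⟨e1, e2⟩ := add_eq_zero.mp (eq_zero_of_weight_eq_zero hw h0)
    exact ⟨e1, (smul_eq_zero.mp e2).resolve_right hab.left_ne_zero⟩
  by_contra hc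
  push Not at hc
  have hu' := hu fun h0 => hc.1 (hzero h0).1 (hzero h0).2
  have hv' := hv fun h0 => hc.2 (hzero h0).1 (hzero h0).2
  exact (hirr.isUnit_or_isUnit huv).elim (not_isUnit_of_mem hI hu') (not_isUnit_of_mem hI hv')

/-- The initial form of an irreducible element, supported on a line, is a constant multiple of a
power of an irreducible binary form in `X^a` and `X^b`. -/
theorem initialForm_of_irreducible
    [IsAdicComplete ((maximalIdeal R).map (algebraMap R S)) S]
    (hI : (maximalIdeal R).map (algebraMap R S) ≠ ⊤) {x : σ → R}
    (hx : Ideal.span (Set.range x) = maximalIdeal R) {a b : σ →₀ ℕ} (hab : IsPrimitivePair a b)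
    {f : MvPolynomial σ R} {γ : σ →₀ ℕ} {φ : Polynomial (ResidueField R)}
    (hφ0 : φ.coeff 0 ≠ 0) (hφ : 0 < φ.natDegree)
    (hf : ∀ δ, f.coeff δ ≠ 0 → Finsupp.weight (rayWeight a b) (γ + φ.natDegree • a) ≤
      Finsupp.weight (rayWeight a b) δ)
    (hfin : ∀ δ, Finsupp.weight (rayWeight a b) δ =
      Finsupp.weight (rayWeight a b) (γ + φ.natDegree • a) →
      residue R (f.coeff δ) = (monomial γ 1 * binaryForm a b φ.natDegree φ).coeff δ)
    (hirr : Irreducible (aeval (fun i => algebraMap R S (x i)) f)) :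
    γ = 0 ∧ ∃ (c : ResidueField R) (ψ : Polynomial (ResidueField R)) (m : ℕ), c ≠ 0 ∧ m ≠ 0 ∧
      Irreducible ψ ∧ φ = Polynomial.C c * ψ ^ m := by
  classical
  have hφne : φ ≠ 0 := by rintro rfl; simp at hφ
  have hy : ∀ i, algebraMap R S (x i) ∈ (maximalIdeal R).map (algebraMap R S) := fun i =>
    Ideal.mem_map_of_mem _ (hx ▸ Ideal.subset_span (Set.mem_range_self i))
  set γ₁ := γ.filter fun i => 0 < a i
  set γ₂ := γ.filter fun i => 0 < b i
  -- The exponent of the variable `i` alone has weight 0 on the ray of r and s, where f has positive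
  -- weight, so it is absent from f. Irreducibility then gives an exponent δ of f with δ i = 0, and
  -- the ray of `i` itself yields γ i = 0.
  have hγ₀ : ∀ i, a i = 0 → b i = 0 → γ i = 0 := by
    intro i hai hbi
    obtain ⟨r, hr, hbr⟩ := hab.exists_left
    obtain ⟨s, hs, has⟩ := hab.exists_right
    have hlin : f.coeff (Finsupp.single i 1) = 0 := by
      by_contra hc
      have := (weight_rayWeight_le_iff.mp (hf _ hc)).1 r s hr hs
      have hir : i ≠ r := by rintro rfl; omega
      have his : i ≠ s := by rintro rfl; omega
      simp only [Finsupp.single_eq_of_ne' hir, Finsupp.single_eq_of_ne' his,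
        Finsupp.add_apply, Finsupp.smul_apply, smul_eq_mul, mul_zero, add_zero] at this
      have hpos := Nat.mul_pos hs (Nat.mul_pos hφ hr)
      rw [mul_add] at this
      omega
    obtain ⟨δ, hδ, hδi⟩ := exists_coeff_ne_zero_of_irreducible hI hy hirr hlin
    have := (weight_rayWeight_le_iff.mp (hf δ hδ)).2 i hai hbi
    simp [hδi] at this
    exact this.1
  have hγ : γ = γ₁ + γ₂ := by
    ext i
    simp only [γ₁, γ₂, Finsupp.add_apply, Finsupp.filter_apply]
    rcases Nat.eq_zero_or_pos (a i) with ha | ha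
    · rcases Nat.eq_zero_or_pos (b i) with hb | hb
      · simp [ha, hb, hγ₀ i ha hb]
      · simp [ha, hb]
    · simp [ha, (hab.disjoint i).resolve_left ha.ne']
  have hγ₁ : ∀ i, γ₁ i ≠ 0 → 0 < a i := fun i hi => by
    by_contra hc
    exact hi (Finsupp.filter_apply_neg _ _ hc)
  have hγ₂ : ∀ i, γ₂ i ≠ 0 → 0 < b i := fun i hi => by
    by_contra hc
    exact hi (Finsupp.filter_apply_neg _ _ hc)
  have key : ∀ g h, IsCoprime g h → φ = g * h →
      (γ₁ = 0 ∧ g.natDegree = 0) ∨ (γ₂ = 0 ∧ h.natDegree = 0) := by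
    intro g h hgh hφgh
    have hg0 : g ≠ 0 := left_ne_zero_of_mul (hφgh ▸ hφne)
    have hh0 : h ≠ 0 := right_ne_zero_of_mul (hφgh ▸ hφne)
    have hdeg : g.natDegree + h.natDegree = φ.natDegree := by
      rw [hφgh, Polynomial.natDegree_mul hg0 hh0]
    refine trivial_of_irreducible_of_isCoprime hI hx hab hgh hg0 ?_ (by omega) hγ₁ hγ₂
      (f := f) ?_ ?_ hirr
    · intro h0
      rw [hφgh, Polynomial.mul_coeff_zero, h0, mul_zero] at hφ0
      exact hφ0 rfl
    · rwa [hdeg, ← hγ]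
    · rwa [hdeg, ← hγ, ← hφgh]
  -- The trivial factorizations of φ split off X^γ₁ and X^γ₂ alone; the complementary factor has
  -- positive weight, so each of these monomials must be 1.
  have e1 := (key 1 φ isCoprime_one_left (one_mul φ).symm).resolve_right fun h => hφ.ne' h.2
  have e2 := (key φ 1 isCoprime_one_right (mul_one φ).symm).resolve_left fun h => hφ.ne' h.2
  exact ⟨by rw [hγ, e1.1, e2.1, add_zero],
    exists_eq_C_mul_pow hφ fun g h hgh he => (key g h hgh he).imp And.right And.right⟩

end Irreducible

end LooseEdge

namespace LooseEdge

/-! ### Compact faces of the polyhedron and the normal cone of a loose edge. -/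

section Faces

variable {n : ℕ}

theorem toPoint_injective : Function.Injective (toPoint (n := n)) := fun α β h =>
  Finsupp.ext fun i => by exact Nat.cast_injective (R := ℝ) (congrFun h i)

theorem dotProduct_nonneg' {ξ v : Fin n → ℝ} (hξ : ∀ i, 0 ≤ ξ i) (hv : ∀ i, 0 ≤ v i) :
    0 ≤ ξ ⬝ᵥ v :=
  Finset.sum_nonneg fun i _ => mul_nonneg (hξ i) (hv i)

theorem eq_zero_of_dotProduct_nonpos {ξ v : Fin n → ℝ} (hξ : ∀ i, 0 < ξ i) (hv : ∀ i, 0 ≤ v i)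
    (h : ξ ⬝ᵥ v ≤ 0) : v = 0 := by
  have h0 := le_antisymm h (dotProduct_nonneg' (fun i => (hξ i).le) hv)
  ext i
  have := (Finset.sum_eq_zero_iff_of_nonneg fun i _ => mul_nonneg (hξ i).le (hv i)).mp h0 i
    (Finset.mem_univ i)
  exact (mul_eq_zero.mp this).resolve_left (hξ i).ne'

/-- The polyhedron spanned by a finite set of exponents. -/
def polyhedron (S : Finset (Fin n →₀ ℕ)) : Set (Fin n → ℝ) :=
  convexHull ℝ (toPoint '' (S : Set (Fin n →₀ ℕ)) + {v : Fin n → ℝ | ∀ i, 0 ≤ v i})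

theorem newtonPolyhedron_eq {R : Type*} [CommRing R] (a : (Fin n →₀ ℕ) →₀ R) :
    newtonPolyhedron a = polyhedron a.support := by
  rw [newtonPolyhedron, polyhedron]
  congr
  ext α
  simp

theorem polyhedron_eq (S : Finset (Fin n →₀ ℕ)) :
    polyhedron S = convexHull ℝ (toPoint '' (S : Set (Fin n →₀ ℕ))) +
      {v : Fin n → ℝ | ∀ i, 0 ≤ v i} := by
  rw [polyhedron, convexHull_add]
  congr 1
  refine Convex.convexHull_eq ?_
  intro v hv w hw s t hs ht _ i
  exact add_nonneg (mul_nonneg hs (hv i)) (mul_nonneg ht (hw i))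

theorem add_mem_polyhedron {S : Finset (Fin n →₀ ℕ)} {p v : Fin n → ℝ} (hp : p ∈ polyhedron S)
    (hv : ∀ i, 0 ≤ v i) : p + v ∈ polyhedron S := by
  rw [polyhedron_eq] at hp ⊢
  obtain ⟨q, hq, w, hw, rfl⟩ := hp
  exact ⟨q, hq, w + v, fun i => add_nonneg (hw i) (hv i), (add_assoc _ _ _).symm⟩

theorem convexHull_subset_polyhedron (S : Finset (Fin n →₀ ℕ)) :
    convexHull ℝ (toPoint '' (S : Set (Fin n →₀ ℕ))) ⊆ polyhedron S := by
  intro p hp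
  rw [polyhedron_eq]
  exact ⟨p, hp, 0, fun _ => le_rfl, add_zero p⟩

theorem toPoint_mem_polyhedron {S : Finset (Fin n →₀ ℕ)} {δ : Fin n →₀ ℕ} (hδ : δ ∈ S) :
    toPoint δ ∈ polyhedron S :=
  convexHull_subset_polyhedron S (subset_convexHull ℝ _ ⟨δ, hδ, rfl⟩)

theorem le_dotProduct_of_mem_convexHull {T : Set (Fin n → ℝ)} {ξ : Fin n → ℝ} {c : ℝ}
    (h : ∀ p ∈ T, c ≤ ξ ⬝ᵥ p) {p : Fin n → ℝ} (hp : p ∈ convexHull ℝ T) : c ≤ ξ ⬝ᵥ p := by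
  have : Convex ℝ {p : Fin n → ℝ | c ≤ ξ ⬝ᵥ p} := by
    intro v hv w hw s t hs ht hst
    simp only [Set.mem_ofPred_eq, dotProduct_add, dotProduct_smul, smul_eq_mul] at *
    have := mul_le_mul_of_nonneg_left hv hs
    have := mul_le_mul_of_nonneg_left hw ht
    calc c = s * c + t * c := by rw [← add_mul, hst, one_mul]
      _ ≤ _ := by linarith
  exact convexHull_min (fun p hp => h p hp) this hp

theorem le_dotProduct_of_mem_polyhedron {S : Finset (Fin n →₀ ℕ)} {ξ : Fin n → ℝ}
    (hξ : ∀ i, 0 ≤ ξ i) {c : ℝ} (h : ∀ δ ∈ S, c ≤ ξ ⬝ᵥ toPoint δ) {p : Fin n → ℝ}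
    (hp : p ∈ polyhedron S) : c ≤ ξ ⬝ᵥ p := by
  rw [polyhedron_eq] at hp
  obtain ⟨q, hq, v, hv, rfl⟩ := hp
  have h1 : c ≤ ξ ⬝ᵥ q := le_dotProduct_of_mem_convexHull (by rintro _ ⟨δ, hδ, rfl⟩; exact h δ hδ) hq
  rw [dotProduct_add]
  linarith [dotProduct_nonneg' hξ hv]

open Classical in
/-- The exponents in `S` at which `⟨ξ, ·⟩` is minimal. -/
noncomputable def minimizers (S : Finset (Fin n →₀ ℕ)) (ξ : Fin n → ℝ) : Finset (Fin n →₀ ℕ) :=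
  S.filter fun δ => ∀ ε ∈ S, ξ ⬝ᵥ toPoint δ ≤ ξ ⬝ᵥ toPoint ε

theorem mem_minimizers {S : Finset (Fin n →₀ ℕ)} {ξ : Fin n → ℝ} {δ : Fin n →₀ ℕ} :
    δ ∈ minimizers S ξ ↔ δ ∈ S ∧ ∀ ε ∈ S, ξ ⬝ᵥ toPoint δ ≤ ξ ⬝ᵥ toPoint ε := by
  classical
  simp [minimizers]

theorem toPoint_mem_faceAt_iff {S : Finset (Fin n →₀ ℕ)} {ξ : Fin n → ℝ} (hξ : ∀ i, 0 ≤ ξ i)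
    {δ : Fin n →₀ ℕ} (hδ : δ ∈ S) :
    toPoint δ ∈ faceAt (polyhedron S) ξ ↔ δ ∈ minimizers S ξ := by
  rw [mem_minimizers]
  exact ⟨fun h => ⟨hδ, fun ε hε => h.2 _ (toPoint_mem_polyhedron hε)⟩, fun h =>
    ⟨toPoint_mem_polyhedron hδ, fun q hq => le_dotProduct_of_mem_polyhedron hξ h.2 hq⟩⟩

/-- A face with positive normal vector is the convex hull of the exponents on it. -/
theorem faceAt_eq_convexHull {S : Finset (Fin n →₀ ℕ)} {ξ : Fin n → ℝ} (hξ : ∀ i, 0 < ξ i) :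
    faceAt (polyhedron S) ξ =
      convexHull ℝ (toPoint '' (minimizers S ξ : Set (Fin n →₀ ℕ))) := by
  classical
  have hξ' : ∀ i, 0 ≤ ξ i := fun i => (hξ i).le
  refine Set.Subset.antisymm ?_ ?_
  · rintro p ⟨hp, hmin⟩
    have hpc : p ∈ convexHull ℝ (toPoint '' (S : Set (Fin n →₀ ℕ))) := by
      rw [polyhedron_eq] at hp
      obtain ⟨q, hq, v, hv, rfl⟩ := hp
      have h1 := hmin q (convexHull_subset_polyhedron S hq)
      dsimp only at h1
      rw [dotProduct_add] at h1
      have h2 := eq_zero_of_dotProduct_nonpos hξ hv (by linarith)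
      simpa [h2] using hq
    have hcoe : (toPoint '' (S : Set (Fin n →₀ ℕ))) = ((S.image toPoint : Finset _) : Set _) := by
      simp
    rw [hcoe, Finset.mem_convexHull'] at hpc
    obtain ⟨w, hw0, hw1, hwp⟩ := hpc
    have hle : ∀ q ∈ S.image toPoint, ξ ⬝ᵥ p ≤ ξ ⬝ᵥ q := by
      intro q hq
      obtain ⟨δ, hδ, rfl⟩ := Finset.mem_image.mp hq
      exact hmin _ (toPoint_mem_polyhedron hδ)
    have hsum : ∑ q ∈ S.image toPoint, w q * (ξ ⬝ᵥ q - ξ ⬝ᵥ p) = 0 := by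
      simp only [mul_sub, Finset.sum_sub_distrib]
      rw [← Finset.sum_mul, hw1, one_mul, sub_eq_zero]
      conv_rhs => rw [← hwp, dotProduct_sum]
      simp [dotProduct_smul]
    have hz := (Finset.sum_eq_zero_iff_of_nonneg fun q hq =>
      mul_nonneg (hw0 q hq) (sub_nonneg.mpr (hle q hq))).mp hsum
    have hcoe' : (toPoint '' (minimizers S ξ : Set (Fin n →₀ ℕ))) =
        (((minimizers S ξ).image toPoint : Finset _) : Set _) := by
      simp
    rw [hcoe', Finset.mem_convexHull']
    have hsub : (minimizers S ξ).image toPoint ⊆ S.image toPoint :=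
      Finset.image_subset_image fun δ hδ => (mem_minimizers.mp hδ).1
    have hw' : ∀ q ∈ S.image toPoint, q ∉ (minimizers S ξ).image toPoint → w q = 0 := by
      intro q hq hq'
      obtain ⟨δ, hδ, rfl⟩ := Finset.mem_image.mp hq
      refine (mul_eq_zero.mp (hz _ hq)).resolve_right fun h0 => hq' ?_
      refine Finset.mem_image_of_mem _ (mem_minimizers.mpr ⟨hδ, fun ε hε => ?_⟩)
      have := hle _ (Finset.mem_image_of_mem toPoint hε)
      linarith
    refine ⟨w, fun q hq => hw0 q (hsub hq), ?_, ?_⟩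
    · rw [Finset.sum_subset hsub hw', hw1]
    · rw [Finset.sum_subset hsub fun q hq hq' => by rw [hw' q hq hq', zero_smul], hwp]
  · intro p hp
    refine ⟨convexHull_subset_polyhedron S (convexHull_mono (Set.image_mono fun δ hδ =>
      (mem_minimizers.mp hδ).1) hp), fun q hq => ?_⟩
    refine le_dotProduct_of_mem_polyhedron hξ' (fun δ hδ => ?_) hq
    have := le_dotProduct_of_mem_convexHull (ξ := -ξ) (c := -(ξ ⬝ᵥ toPoint δ)) (by
      rintro _ ⟨ε, hε, rfl⟩
      rw [neg_dotProduct, neg_le_neg_iff]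
      exact (mem_minimizers.mp hε).2 δ hδ) hp
    rwa [neg_dotProduct, neg_le_neg_iff] at this

theorem isCompact_faceAt {S : Finset (Fin n →₀ ℕ)} {ξ : Fin n → ℝ} (hξ : ∀ i, 0 < ξ i) :
    IsCompact (faceAt (polyhedron S) ξ) := by
  rw [faceAt_eq_convexHull hξ]
  exact ((Finset.finite_toSet _).image _).isCompact_convexHull ℝ

theorem vectorSpan_faceAt {S : Finset (Fin n →₀ ℕ)} {ξ : Fin n → ℝ} (hξ : ∀ i, 0 < ξ i) :
    vectorSpan ℝ (faceAt (polyhedron S) ξ) =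
      vectorSpan ℝ (toPoint '' (minimizers S ξ : Set (Fin n →₀ ℕ))) := by
  rw [faceAt_eq_convexHull hξ, ← direction_affineSpan, affineSpan_convexHull, direction_affineSpan]

/-- If `ξ i` vanished, the face would be stable under translation along the `i`-th axis and hence
unbounded. -/
theorem pos_of_isCompact_faceAt {S : Finset (Fin n →₀ ℕ)} {ξ : Fin n → ℝ} (hξ : ∀ i, 0 ≤ ξ i)
    (hc : IsCompact (faceAt (polyhedron S) ξ)) (hne : (faceAt (polyhedron S) ξ).Nonempty)
    (i : Fin n) : 0 < ξ i := by
  by_contra hi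
  have hi0 : ξ i = 0 := le_antisymm (not_lt.mp hi) (hξ i)
  obtain ⟨p, hp, hmin⟩ := hne
  obtain ⟨C, hC⟩ := hc.isBounded.exists_norm_le
  have hmem : ∀ t : ℝ, 0 ≤ t → p + Pi.single i t ∈ faceAt (polyhedron S) ξ := by
    intro t ht
    refine ⟨add_mem_polyhedron hp fun j => ?_, fun q hq => ?_⟩
    · by_cases hj : j = i
      · subst hj; simpa using ht
      · simp [hj]
    · rw [dotProduct_add, dotProduct_single, hi0, zero_mul, add_zero]
      exact hmin q hq
  have h1 := (norm_le_pi_norm _ i).trans (hC _ (hmem (|C| + |p i| + 1) (by positivity)))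
  simp only [Pi.add_apply, Pi.single_eq_same, Real.norm_eq_abs] at h1
  have h2 := (le_abs_self _).trans h1
  linarith [neg_abs_le (p i), le_abs_self C]

/-- A compact edge is cut out by a positive vector. -/
theorem IsCompactEdge.exists_pos {S : Finset (Fin n →₀ ℕ)} {E : Set (Fin n → ℝ)}
    (hE : IsCompactEdge (polyhedron S) E) :
    ∃ ξ : Fin n → ℝ, (∀ i, 0 < ξ i) ∧ E = faceAt (polyhedron S) ξ := by
  obtain ⟨⟨ξ, hξ, rfl⟩, hc, hd⟩ := hE
  refine ⟨ξ, pos_of_isCompact_faceAt hξ hc ?_, rfl⟩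
  by_contra hne
  rw [Set.not_nonempty_iff_eq_empty] at hne
  rw [faceDim, hne, vectorSpan_empty, finrank_bot] at hd
  omega

theorem exists_smul_eq_of_finrank_eq_one {V : Submodule ℝ (Fin n → ℝ)}
    (hV : Module.finrank ℝ V = 1) {v w : Fin n → ℝ} (hv : v ∈ V) (hv0 : v ≠ 0) (hw : w ∈ V) :
    ∃ c : ℝ, w = c • v := by
  obtain ⟨c, hc⟩ := (finrank_eq_one_iff_of_nonzero' (⟨v, hv⟩ : V)
    fun h0 => hv0 (congrArg Subtype.val h0)).mp hV ⟨w, hw⟩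
  exact ⟨c, (congrArg Subtype.val hc).symm⟩

/-- The exponents on a compact edge lie on a line. -/
theorem exists_smul_eq_of_faceDim_eq_one {S : Finset (Fin n →₀ ℕ)} {ξ : Fin n → ℝ}
    (hξ : ∀ i, 0 < ξ i) (hd : faceDim (faceAt (polyhedron S) ξ) = 1) {δ₁ δ₂ δ : Fin n →₀ ℕ}
    (h₁ : δ₁ ∈ minimizers S ξ) (h₂ : δ₂ ∈ minimizers S ξ) (hne : δ₁ ≠ δ₂)
    (h : δ ∈ minimizers S ξ) : ∃ c : ℝ, toPoint δ - toPoint δ₁ = c • (toPoint δ₂ - toPoint δ₁) := by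
  rw [faceDim, vectorSpan_faceAt hξ] at hd
  have hmem : ∀ {ε}, ε ∈ minimizers S ξ → toPoint ε - toPoint δ₁ ∈
      vectorSpan ℝ (toPoint '' (minimizers S ξ : Set (Fin n →₀ ℕ))) := fun hε =>
    vsub_mem_vectorSpan ℝ ⟨_, hε, rfl⟩ ⟨_, h₁, rfl⟩
  exact exists_smul_eq_of_finrank_eq_one hd (hmem h₂)
    (fun h0 => hne (toPoint_injective (sub_eq_zero.mp h0)).symm) (hmem h)

theorem exists_ne_of_faceDim_eq_one {S : Finset (Fin n →₀ ℕ)} {ξ : Fin n → ℝ}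
    (hξ : ∀ i, 0 < ξ i) (hd : faceDim (faceAt (polyhedron S) ξ) = 1) :
    ∃ δ₁ ∈ minimizers S ξ, ∃ δ₂ ∈ minimizers S ξ, δ₁ ≠ δ₂ := by
  by_contra hc
  push Not at hc
  rw [faceDim, vectorSpan_faceAt hξ, vectorSpan_of_subsingleton, finrank_bot] at hd
  · omega
  · rintro _ ⟨δ, hδ, rfl⟩ _ ⟨ε, hε, rfl⟩
    rw [hc δ hδ ε hε]

/-- ξ₀ kills the nonzero vector from δ₁ to δ₂ but not the one from δ₁ to δ, so the two are
independent. -/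
theorem two_le_faceDim {S : Finset (Fin n →₀ ℕ)} {ξ ξ₀ : Fin n → ℝ} (hξ : ∀ i, 0 < ξ i)
    {δ δ₁ δ₂ : Fin n →₀ ℕ} (h : δ ∈ minimizers S ξ) (h₁ : δ₁ ∈ minimizers S ξ)
    (h₂ : δ₂ ∈ minimizers S ξ) (hne : δ₁ ≠ δ₂) (heq : ξ₀ ⬝ᵥ (toPoint δ₂ - toPoint δ₁) = 0)
    (hδ : ξ₀ ⬝ᵥ (toPoint δ - toPoint δ₁) ≠ 0) : 2 ≤ faceDim (faceAt (polyhedron S) ξ) := by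
  rw [faceDim, vectorSpan_faceAt hξ]
  have hmem : ∀ {ε}, ε ∈ minimizers S ξ → toPoint ε - toPoint δ₁ ∈
      vectorSpan ℝ (toPoint '' (minimizers S ξ : Set (Fin n →₀ ℕ))) := fun hε =>
    vsub_mem_vectorSpan ℝ ⟨_, hε, rfl⟩ ⟨_, h₁, rfl⟩
  have hli : LinearIndependent ℝ ![toPoint δ₂ - toPoint δ₁, toPoint δ - toPoint δ₁] := by
    refine LinearIndependent.pair_iff.mpr fun s t hst => ?_
    have h3 := congrArg (ξ₀ ⬝ᵥ ·) hst
    simp only [dotProduct_add, dotProduct_smul, heq, smul_eq_mul, mul_zero, zero_add,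
      dotProduct_zero] at h3
    have ht : t = 0 := (mul_eq_zero.mp h3).resolve_right hδ
    rw [ht, zero_smul, add_zero] at hst
    exact ⟨(smul_eq_zero.mp hst).resolve_right fun h0 =>
      hne (toPoint_injective (sub_eq_zero.mp h0)).symm, ht⟩
  have := Submodule.finrank_mono (Submodule.span_le.mpr (by
    rintro _ ⟨i, rfl⟩
    fin_cases i
    · exact hmem h₂
    · exact hmem h : Set.range ![toPoint δ₂ - toPoint δ₁, toPoint δ - toPoint δ₁] ⊆
        (vectorSpan ℝ (toPoint '' (minimizers S ξ : Set (Fin n →₀ ℕ))) : Set (Fin n → ℝ))))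
  rwa [finrank_span_eq_card hli, Fintype.card_fin] at this

/-- The normal cone of a loose edge is a full section of the orthant by the hyperplane orthogonal to
the edge. -/
theorem IsLooseEdge.le_dotProduct {S : Finset (Fin n →₀ ℕ)} {ξ₀ : Fin n → ℝ} (hξ₀ : ∀ i, 0 < ξ₀ i)
    (hE : IsLooseEdge (polyhedron S) (faceAt (polyhedron S) ξ₀)) {δ₁ δ₂ : Fin n →₀ ℕ}
    (h₁ : δ₁ ∈ minimizers S ξ₀) (h₂ : δ₂ ∈ minimizers S ξ₀) (hne : δ₁ ≠ δ₂) {η : Fin n → ℝ}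
    (hη : ∀ i, 0 ≤ η i) (hη0 : η ⬝ᵥ (toPoint δ₂ - toPoint δ₁) = 0) {ε : Fin n →₀ ℕ} (hε : ε ∈ S) :
    η ⬝ᵥ toPoint δ₁ ≤ η ⬝ᵥ toPoint ε := by
  classical
  by_contra hc
  push Not at hc
  have hline := fun {δ} => exists_smul_eq_of_faceDim_eq_one (δ := δ) hξ₀ hE.1.2.2 h₁ h₂ hne
  have hηM : ∀ δ ∈ minimizers S ξ₀, η ⬝ᵥ toPoint δ = η ⬝ᵥ toPoint δ₁ := by
    intro δ hδ
    obtain ⟨c, hc⟩ := hline hδ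
    have := congrArg (η ⬝ᵥ ·) hc
    simp only [dotProduct_smul, hη0, smul_zero, dotProduct_sub η (toPoint δ)] at this
    linarith
  have hξM : ∀ δ ∈ minimizers S ξ₀, ξ₀ ⬝ᵥ toPoint δ = ξ₀ ⬝ᵥ toPoint δ₁ := fun δ hδ =>
    le_antisymm ((mem_minimizers.mp hδ).2 _ (mem_minimizers.mp h₁).1)
      ((mem_minimizers.mp h₁).2 _ (mem_minimizers.mp hδ).1)
  -- The minimal ratio t is the first value at which ξ₀ + t η takes at some ε₀ with smaller η-value
  -- the same value as on the edge. Up to there the edge stays minimal, so the tilted face contains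
  -- both the edge and ε₀.
  obtain ⟨ε₀, hε₀, hmin⟩ := Finset.exists_min_image
    (S.filter fun ε => η ⬝ᵥ toPoint ε < η ⬝ᵥ toPoint δ₁)
    (fun ε => (ξ₀ ⬝ᵥ toPoint ε - ξ₀ ⬝ᵥ toPoint δ₁) / (η ⬝ᵥ toPoint δ₁ - η ⬝ᵥ toPoint ε))
    ⟨ε, by simpa using ⟨hε, hc⟩⟩
  simp only [Finset.mem_filter] at hε₀ hmin
  set t := (ξ₀ ⬝ᵥ toPoint ε₀ - ξ₀ ⬝ᵥ toPoint δ₁) / (η ⬝ᵥ toPoint δ₁ - η ⬝ᵥ toPoint ε₀) with ht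
  have hpos₀ : 0 < η ⬝ᵥ toPoint δ₁ - η ⬝ᵥ toPoint ε₀ := sub_pos.mpr hε₀.2
  have hξle : ∀ ε ∈ S, 0 ≤ ξ₀ ⬝ᵥ toPoint ε - ξ₀ ⬝ᵥ toPoint δ₁ := fun ε hε =>
    sub_nonneg.mpr ((mem_minimizers.mp h₁).2 ε hε)
  have ht0 : 0 ≤ t := div_nonneg (hξle _ hε₀.1) hpos₀.le
  have hteq : t * (η ⬝ᵥ toPoint δ₁ - η ⬝ᵥ toPoint ε₀) = ξ₀ ⬝ᵥ toPoint ε₀ - ξ₀ ⬝ᵥ toPoint δ₁ :=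
    div_mul_cancel₀ _ hpos₀.ne'
  have hdot : ∀ δ, (ξ₀ + t • η) ⬝ᵥ toPoint δ = ξ₀ ⬝ᵥ toPoint δ + t * (η ⬝ᵥ toPoint δ) := fun δ => by
    rw [add_dotProduct, smul_dotProduct, smul_eq_mul]
  have hle : ∀ ε ∈ S, (ξ₀ + t • η) ⬝ᵥ toPoint δ₁ ≤ (ξ₀ + t • η) ⬝ᵥ toPoint ε := by
    intro ε hε
    rw [hdot, hdot]
    rcases lt_or_ge (η ⬝ᵥ toPoint ε) (η ⬝ᵥ toPoint δ₁) with h | h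
    · have h3 := (le_div_iff₀ (sub_pos.mpr h)).mp (hmin ε ⟨hε, h⟩)
      linarith
    · have h3 := mul_le_mul_of_nonneg_left h ht0
      linarith [hξle ε hε]
  have hpos : ∀ i, 0 < (ξ₀ + t • η) i := fun i =>
    add_pos_of_pos_of_nonneg (hξ₀ i) (mul_nonneg ht0 (hη i))
  have hmemM : ∀ δ ∈ S, (ξ₀ + t • η) ⬝ᵥ toPoint δ = (ξ₀ + t • η) ⬝ᵥ toPoint δ₁ →
      δ ∈ minimizers S (ξ₀ + t • η) := fun δ hδ h =>
    mem_minimizers.mpr ⟨hδ, fun ε hε => h ▸ hle ε hε⟩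
  have hsub : ∀ δ ∈ minimizers S ξ₀, δ ∈ minimizers S (ξ₀ + t • η) := fun δ hδ =>
    hmemM δ (mem_minimizers.mp hδ).1 (by rw [hdot, hdot, hηM δ hδ, hξM δ hδ])
  refine hE.2 (faceAt (polyhedron S) (ξ₀ + t • η)) ⟨_, fun i => (hpos i).le, rfl⟩
    (isCompact_faceAt hpos) ?_ ?_
  · rw [faceAt_eq_convexHull hξ₀, faceAt_eq_convexHull hpos]
    exact convexHull_mono (Set.image_mono hsub)
  · refine two_le_faceDim (ξ₀ := ξ₀) hpos (hmemM ε₀ hε₀.1 ?_) (hsub _ h₁) (hsub _ h₂) hne ?_ ?_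
    · rw [hdot, hdot]; linarith
    · rw [dotProduct_sub, hξM _ h₂, sub_self]
    · rw [dotProduct_sub]
      intro h0
      have h3 : ε₀ ∈ minimizers S ξ₀ := mem_minimizers.mpr ⟨hε₀.1, fun ε hε => by
        linarith [hξle ε hε]⟩
      exact hε₀.2.ne (hηM _ h3)

end Faces

end LooseEdge

namespace LooseEdge

/-! ### From loose edges to primitive directions and ray weights; uniqueness of the edge. -/

section Directions

variable {n : ℕ}

/-- The direction of a segment orthogonal to a positive vector is spanned by a primitive vector with
coordinates of both signs. -/
theorem exists_isPrimitivePair {ξ : Fin n → ℝ} (hξ : ∀ i, 0 < ξ i) {δ₁ δ₂ : Fin n →₀ ℕ}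
    (hne : δ₁ ≠ δ₂) (h : ξ ⬝ᵥ toPoint δ₂ = ξ ⬝ᵥ toPoint δ₁) :
    ∃ a b : Fin n →₀ ℕ, IsPrimitivePair a b ∧
      ∃ c : ℝ, c ≠ 0 ∧ ∀ i, toPoint δ₂ i - toPoint δ₁ i = c * (toPoint a i - toPoint b i) := by
  obtain ⟨i₀, hi₀⟩ := Finsupp.ne_iff.mp hne
  obtain ⟨v, hv, hv1⟩ := Finset.extract_gcd (s := Finset.univ)
    (fun i => (δ₂ i : ℤ) - δ₁ i) ⟨i₀, Finset.mem_univ _⟩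
  set g := Finset.univ.gcd fun i => (δ₂ i : ℤ) - δ₁ i
  have hv' : ∀ i, (δ₂ i : ℤ) - δ₁ i = g * v i := fun i => hv i (Finset.mem_univ i)
  have hg : g ≠ 0 := by
    intro h0
    have := hv' i₀
    rw [h0, zero_mul] at this
    omega
  have hgR : (g : ℝ) ≠ 0 := by exact_mod_cast hg
  have hvR : ∀ i, toPoint δ₂ i - toPoint δ₁ i = (g : ℝ) * v i := fun i => by
    have := congrArg (Int.cast : ℤ → ℝ) (hv' i)
    push_cast at this
    exact this
  have hdot : ∑ i, ξ i * (v i : ℝ) = 0 := by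
    apply mul_left_cancel₀ hgR
    rw [mul_zero, ← sub_eq_zero.mpr h, ← dotProduct_sub, Finset.mul_sum]
    refine Finset.sum_congr rfl fun i _ => ?_
    rw [Pi.sub_apply, hvR]
    ring
  have hv0 : v ≠ 0 := by
    rintro rfl
    have := hv' i₀
    simp at this
    omega
  have hneg : ¬ ∀ i, v i ≤ 0 := by
    intro hle
    have h1 := (Finset.sum_eq_zero_iff_of_nonpos (s := Finset.univ)
      (f := fun i => ξ i * (v i : ℝ)) fun i _ =>
        mul_nonpos_of_nonneg_of_nonpos (hξ i).le (by exact_mod_cast hle i)).mp hdot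
    refine hv0 (funext fun i => ?_)
    exact_mod_cast (mul_eq_zero.mp (h1 i (Finset.mem_univ i))).resolve_left (hξ i).ne'
  have hpos : ¬ ∀ i, 0 ≤ v i := by
    intro hle
    have h1 := (Finset.sum_eq_zero_iff_of_nonneg (s := Finset.univ)
      (f := fun i => ξ i * (v i : ℝ)) fun i _ =>
        mul_nonneg (hξ i).le (by exact_mod_cast hle i)).mp hdot
    refine hv0 (funext fun i => ?_)
    exact_mod_cast (mul_eq_zero.mp (h1 i (Finset.mem_univ i))).resolve_left (hξ i).ne'
  refine ⟨Finsupp.equivFunOnFinite.symm fun i => (v i).toNat,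
    Finsupp.equivFunOnFinite.symm fun i => (-v i).toNat, ⟨fun i => ?_, ?_, ?_, ?_⟩, g, hgR,
    fun i => ?_⟩
  · simp only [Finsupp.equivFunOnFinite_symm_apply_apply]; omega
  · intro h0
    refine hneg fun i => ?_
    have := DFunLike.congr_fun h0 i
    simpa using this
  · intro h0
    refine hpos fun i => ?_
    have := DFunLike.congr_fun h0 i
    simpa using this
  · obtain ⟨e, he⟩ := Finset.gcd_eq_sum_mul Finset.univ v
    refine ⟨e, ?_⟩
    rw [← hv1, he]
    refine Finset.sum_congr rfl fun i _ => ?_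
    simp only [Finsupp.equivFunOnFinite_symm_apply_apply, Int.toNat_sub_toNat_neg]
    ring
  · rw [hvR]
    congr 1
    simp only [toPoint, Finsupp.equivFunOnFinite_symm_apply_apply]
    have := congrArg (Int.cast : ℤ → ℝ) (Int.toNat_sub_toNat_neg (v i))
    push_cast at this
    exact this.symm

theorem IsPrimitivePair.isPrimitiveVector {a b : Fin n →₀ ℕ} (h : IsPrimitivePair a b) :
    IsPrimitiveVector fun i => (a i : ℤ) - b i := by
  obtain ⟨e, he⟩ := h.exists_bezout
  have hdvd : Finset.univ.gcd (fun i => (a i : ℤ) - b i) ∣ 1 := by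
    rw [← he]
    exact Finset.dvd_sum fun i hi => (Finset.gcd_dvd hi).mul_left _
  rw [IsPrimitiveVector, ← Finset.normalize_gcd]
  exact normalize_eq_one.mpr (isUnit_of_dvd_one hdvd)

theorem dotProduct_ray (p q : ℝ) (r s : Fin n) (v : Fin n → ℝ) :
    (Pi.single r p + Pi.single s q) ⬝ᵥ v = p * v r + q * v s := by
  rw [add_dotProduct, single_dotProduct, single_dotProduct]

theorem single_apply_nonneg {p : ℝ} (hp : 0 ≤ p) (r i : Fin n) :
    0 ≤ (Pi.single r p : Fin n → ℝ) i := by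
  rw [Pi.single_apply]
  split_ifs
  exacts [hp, le_rfl]

/-- All exponents have weights at least those of the exponents on a loose edge. -/
theorem IsLooseEdge.weight_le {S : Finset (Fin n →₀ ℕ)} {ξ₀ : Fin n → ℝ} (hξ₀ : ∀ i, 0 < ξ₀ i)
    (hE : IsLooseEdge (polyhedron S) (faceAt (polyhedron S) ξ₀)) {δ₁ δ₂ : Fin n →₀ ℕ}
    (h₁ : δ₁ ∈ minimizers S ξ₀) (h₂ : δ₂ ∈ minimizers S ξ₀) (hne : δ₁ ≠ δ₂) {a b : Fin n →₀ ℕ}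
    (hab : IsPrimitivePair a b) {c : ℝ}
    (hc : ∀ i, toPoint δ₂ i - toPoint δ₁ i = c * (toPoint a i - toPoint b i)) {ε : Fin n →₀ ℕ}
    (hε : ε ∈ S) : Finsupp.weight (rayWeight a b) δ₁ ≤ Finsupp.weight (rayWeight a b) ε := by
  have key := fun {η} => IsLooseEdge.le_dotProduct (η := η) hξ₀ hE h₁ h₂ hne
  refine weight_rayWeight_le_iff.mpr ⟨fun r s hr hs => ?_, fun r hr hs => ?_⟩
  · have h3 := key (η := Pi.single r (b s : ℝ) + Pi.single s (a r : ℝ))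
      (fun i => add_nonneg (single_apply_nonneg (Nat.cast_nonneg _) r i)
        (single_apply_nonneg (Nat.cast_nonneg _) s i)) (by
      rw [dotProduct_ray, Pi.sub_apply, Pi.sub_apply, hc, hc]
      simp only [toPoint, (hab.disjoint r).resolve_left hr.ne',
        (hab.disjoint s).resolve_right hs.ne', Nat.cast_zero]
      ring) hε
    rw [dotProduct_ray, dotProduct_ray] at h3
    simp only [toPoint] at h3
    exact_mod_cast h3
  · have h3 := key (η := Pi.single r 1) (single_apply_nonneg zero_le_one r) (by
      rw [single_dotProduct, Pi.sub_apply, hc]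
      simp [toPoint, hr, hs]) hε
    rw [single_dotProduct, single_dotProduct, one_mul, one_mul] at h3
    exact Nat.cast_le.mp h3

theorem toPoint_sub_eq_of_weight_eq {a b : Fin n →₀ ℕ} (hab : IsPrimitivePair a b)
    {δ ε : Fin n →₀ ℕ}
    (h : Finsupp.weight (rayWeight a b) δ = Finsupp.weight (rayWeight a b) ε) :
    ∃ c : ℝ, toPoint δ - toPoint ε = c • (toPoint a - toPoint b) := by
  obtain ⟨j, hj⟩ := exists_eq_mul_of_weight_eq hab h
  refine ⟨j, funext fun i => ?_⟩
  have := congrArg (Int.cast : ℤ → ℝ) (hj i)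
  push_cast at this
  exact this

/-- The combinatorial description of a loose edge in terms of weights. -/
theorem IsLooseEdge.exists_isPrimitivePair {S : Finset (Fin n →₀ ℕ)} {E : Set (Fin n → ℝ)}
    (hE : IsLooseEdge (polyhedron S) E) :
    ∃ (ξ : Fin n → ℝ) (a b δ₁ δ₂ : Fin n →₀ ℕ), (∀ i, 0 < ξ i) ∧ E = faceAt (polyhedron S) ξ ∧
      IsPrimitivePair a b ∧ δ₁ ∈ minimizers S ξ ∧ δ₂ ∈ minimizers S ξ ∧ δ₁ ≠ δ₂ ∧
      (∀ ε ∈ S, Finsupp.weight (rayWeight a b) δ₁ ≤ Finsupp.weight (rayWeight a b) ε) ∧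
      ∀ ε ∈ S, ε ∈ minimizers S ξ ↔
        Finsupp.weight (rayWeight a b) ε = Finsupp.weight (rayWeight a b) δ₁ := by
  obtain ⟨ξ, hξ, rfl⟩ := IsCompactEdge.exists_pos hE.1
  obtain ⟨δ₁, h₁, δ₂, h₂, hne⟩ := exists_ne_of_faceDim_eq_one hξ hE.1.2.2
  have hmin : ∀ {δ ε}, δ ∈ minimizers S ξ → ε ∈ minimizers S ξ →
      ξ ⬝ᵥ toPoint δ = ξ ⬝ᵥ toPoint ε := fun hδ hε =>
    le_antisymm ((mem_minimizers.mp hδ).2 _ (mem_minimizers.mp hε).1)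
      ((mem_minimizers.mp hε).2 _ (mem_minimizers.mp hδ).1)
  obtain ⟨a, b, hab, c, hc0, hc⟩ := LooseEdge.exists_isPrimitivePair hξ hne (hmin h₂ h₁)
  have hW : ∀ ε ∈ S, Finsupp.weight (rayWeight a b) δ₁ ≤ Finsupp.weight (rayWeight a b) ε :=
    fun ε hε => IsLooseEdge.weight_le hξ hE h₁ h₂ hne hab hc hε
  refine ⟨ξ, a, b, δ₁, δ₂, hξ, rfl, hab, h₁, h₂, hne, hW, fun ε hε => ⟨fun hεM => ?_, fun h => ?_⟩⟩
  · by_cases hε1 : ε = δ₁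
    · rw [hε1]
    refine le_antisymm ?_ (hW ε hε)
    obtain ⟨t, ht⟩ := exists_smul_eq_of_faceDim_eq_one hξ hE.1.2.2 h₁ h₂ hne hεM
    -- Any exponent on the edge may serve as base point: this is the same inequality with ε and δ₁
    -- exchanged.
    refine IsLooseEdge.weight_le hξ hE hεM h₁ hε1 hab (c := -(t * c)) (fun i => ?_)
      (mem_minimizers.mp h₁).1
    have := congrFun ht i
    simp only [Pi.sub_apply, Pi.smul_apply, smul_eq_mul, hc] at this
    linear_combination -this
  · obtain ⟨t, ht⟩ := toPoint_sub_eq_of_weight_eq hab h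
    have h3 : c * (ξ ⬝ᵥ (toPoint a - toPoint b)) = 0 := by
      rw [← smul_eq_mul, ← dotProduct_smul,
        show c • (toPoint a - toPoint b) = toPoint δ₂ - toPoint δ₁ from
          funext fun i => (hc i).symm, dotProduct_sub, hmin h₂ h₁, sub_self]
    have h4 := congrArg (ξ ⬝ᵥ ·) ht
    simp only [dotProduct_smul, (mul_eq_zero.mp h3).resolve_left hc0, smul_zero] at h4
    rw [dotProduct_sub, sub_eq_zero] at h4
    exact mem_minimizers.mpr ⟨hε, fun ε' hε' => h4 ▸ (mem_minimizers.mp h₁).2 ε' hε'⟩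

/-- If all weights of `ε` are at least those of `k a`, then `⟨ξ, ε⟩ ≥ ⟨ξ, k b⟩` for positive `ξ` with
`⟨ξ, b⟩ ≤ ⟨ξ, a⟩`, and equality with `⟨ξ, b⟩ < ⟨ξ, a⟩` forces `ε = k b`. -/
theorem le_dotProduct_of_mul_le {a b : Fin n →₀ ℕ} (hab : IsPrimitivePair a b) {k : ℕ}
    {ε : Fin n →₀ ℕ} (h : ∀ r s, 0 < a r → 0 < b s → k * (a r * b s) ≤ b s * ε r + a r * ε s)
    {ξ : Fin n → ℝ} (hξ : ∀ i, 0 < ξ i) (hle : ξ ⬝ᵥ toPoint b ≤ ξ ⬝ᵥ toPoint a) :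
    k * (ξ ⬝ᵥ toPoint b) ≤ ξ ⬝ᵥ toPoint ε ∧
      (ξ ⬝ᵥ toPoint b < ξ ⬝ᵥ toPoint a → ξ ⬝ᵥ toPoint ε ≤ k * (ξ ⬝ᵥ toPoint b) →
        ε = k • b) := by
  have hξ' : ∀ i, 0 ≤ ξ i := fun i => (hξ i).le
  obtain ⟨s₀, hs₀, -⟩ := hab.exists_right
  obtain ⟨s, hs, hmin⟩ := Finset.exists_min_image (Finset.univ.filter fun i => 0 < b i)
    (fun i => (ε i : ℝ) / b i) ⟨s₀, by simpa using hs₀⟩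
  simp only [Finset.mem_filter, Finset.mem_univ, true_and] at hs hmin
  have hbs : (0 : ℝ) < b s := by exact_mod_cast hs
  -- m is the largest real number with m b ≤ ε. If k ≤ m, then ε dominates k b; otherwise the ray
  -- inequalities at s show that ε dominates m b + (k - m) a.
  set m := (ε s : ℝ) / b s with hm
  have hms : m * b s = ε s := div_mul_cancel₀ _ hbs.ne'
  have hmb : ∀ i, m * b i ≤ ε i := by
    intro i
    rcases Nat.eq_zero_or_pos (b i) with hi | hi
    · simp [hi]
    · exact (le_div_iff₀ (by exact_mod_cast hi)).mp (hmin i hi)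
  rcases le_or_gt (k : ℝ) m with hk | hk
  · have hv : ∀ i, 0 ≤ (toPoint ε - (k : ℝ) • toPoint b) i := by
      intro i
      have := mul_le_mul_of_nonneg_right hk (Nat.cast_nonneg (α := ℝ) (b i))
      simp only [Pi.sub_apply, Pi.smul_apply, smul_eq_mul, toPoint]
      linarith [hmb i]
    have h1 := dotProduct_nonneg' hξ' hv
    rw [dotProduct_sub, dotProduct_smul, smul_eq_mul] at h1
    refine ⟨by linarith, fun _ h2 => ?_⟩
    have h3 := eq_zero_of_dotProduct_nonpos hξ hv (by
      rw [dotProduct_sub, dotProduct_smul, smul_eq_mul]; linarith)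
    ext i
    have := congrFun h3 i
    simp only [Pi.sub_apply, Pi.smul_apply, smul_eq_mul, toPoint, Pi.zero_apply] at this
    rw [Finsupp.smul_apply, smul_eq_mul]
    exact_mod_cast sub_eq_zero.mp this
  · have hv : ∀ i, 0 ≤ (toPoint ε - m • toPoint b - ((k : ℝ) - m) • toPoint a) i := by
      intro i
      simp only [Pi.sub_apply, Pi.smul_apply, smul_eq_mul, toPoint]
      rcases Nat.eq_zero_or_pos (a i) with hi | hi
      · rw [hi, Nat.cast_zero, mul_zero]; linarith [hmb i]
      · rw [(hab.disjoint i).resolve_left hi.ne']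
        have h1 : (k : ℝ) * (a i * b s) ≤ b s * ε i + a i * ε s := by exact_mod_cast h i s hi hs
        rw [← hms] at h1
        have h2 : 0 ≤ (b s : ℝ) * (ε i - (k - m) * a i) := by linarith
        have h3 := nonneg_of_mul_nonneg_right h2 hbs
        push_cast
        linarith
    have h1 := dotProduct_nonneg' hξ' hv
    rw [dotProduct_sub, dotProduct_sub, dotProduct_smul, dotProduct_smul, smul_eq_mul,
      smul_eq_mul] at h1
    have h2 := mul_le_mul_of_nonneg_left hle (sub_pos.mpr hk).le
    refine ⟨by linarith, fun hlt h3 => ?_⟩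
    have h4 := mul_lt_mul_of_pos_left hlt (sub_pos.mpr hk)
    linarith

theorem dotProduct_toPoint_smul (ξ : Fin n → ℝ) (k : ℕ) (δ : Fin n →₀ ℕ) :
    ξ ⬝ᵥ toPoint (k • δ) = k * (ξ ⬝ᵥ toPoint δ) := by
  have : toPoint (k • δ) = (k : ℝ) • toPoint δ := by
    ext i
    simp [toPoint]
  rw [this, dotProduct_smul, smul_eq_mul]

/-- Such a ξ is minimal on S only at k b, so its face is a single point. -/
theorem le_dotProduct_of_edge {S : Finset (Fin n →₀ ℕ)} {a b : Fin n →₀ ℕ}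
    (hab : IsPrimitivePair a b) {k : ℕ} (hkb : k • b ∈ S)
    (hS : ∀ ε ∈ S, ∀ r s, 0 < a r → 0 < b s → k * (a r * b s) ≤ b s * ε r + a r * ε s)
    {ξ : Fin n → ℝ} (hξ : ∀ i, 0 < ξ i) (hlt : ξ ⬝ᵥ toPoint b < ξ ⬝ᵥ toPoint a) :
    faceDim (faceAt (polyhedron S) ξ) ≠ 1 := by
  intro hd
  obtain ⟨δ₁, h₁, δ₂, h₂, hne⟩ := exists_ne_of_faceDim_eq_one hξ hd
  have : ∀ δ ∈ minimizers S ξ, δ = k • b := fun δ hδ =>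
    (le_dotProduct_of_mul_le hab (hS δ (mem_minimizers.mp hδ).1) hξ hlt.le).2 hlt
      (dotProduct_toPoint_smul ξ k b ▸ (mem_minimizers.mp hδ).2 _ hkb)
  exact hne ((this _ h₁).trans (this _ h₂).symm)

/-- An edge joining `k a` and `k b`, below all exponents with respect to the weights, is the only
compact edge. -/
theorem eq_of_isCompactEdge {S : Finset (Fin n →₀ ℕ)} {a b : Fin n →₀ ℕ}
    (hab : IsPrimitivePair a b) {k : ℕ} (hk : 0 < k) (hka : k • a ∈ S) (hkb : k • b ∈ S)
    (hS : ∀ ε ∈ S, Finsupp.weight (rayWeight a b) (k • a) ≤ Finsupp.weight (rayWeight a b) ε)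
    {ξ₀ : Fin n → ℝ} (hξ₀ : ∀ i, 0 < ξ₀ i) (hM : ∀ ε ∈ S, ε ∈ minimizers S ξ₀ ↔
      Finsupp.weight (rayWeight a b) ε = Finsupp.weight (rayWeight a b) (k • a))
    {E : Set (Fin n → ℝ)} (hE : IsCompactEdge (polyhedron S) E) :
    E = faceAt (polyhedron S) ξ₀ := by
  obtain ⟨ξ, hξ, rfl⟩ := IsCompactEdge.exists_pos hE
  have hS' : ∀ ε ∈ S, ∀ r s, 0 < a r → 0 < b s →
      k * (a r * b s) ≤ b s * ε r + a r * ε s := by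
    intro ε hε r s hr hs
    have := (weight_rayWeight_le_iff.mp (hS ε hε)).1 r s hr hs
    simp only [Finsupp.smul_apply, smul_eq_mul, (hab.disjoint s).resolve_right hs.ne',
      mul_zero, add_zero] at this
    calc k * (a r * b s) = b s * (k * a r) := by ring
      _ ≤ _ := this
  -- If ξ separates a and b, its face is a vertex. Otherwise k a and k b are both minimizers, so the
  -- edge spans the same line as the given one and has the same exponents.
  rcases lt_trichotomy (ξ ⬝ᵥ toPoint b) (ξ ⬝ᵥ toPoint a) with hlt | heq | hgt
  · exact absurd hE.2.2 (le_dotProduct_of_edge hab hkb hS' hξ hlt)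
  · have hwab : Finsupp.weight (rayWeight a b) (k • b) = Finsupp.weight (rayWeight a b) (k • a) := by
      rw [map_nsmul, map_nsmul, weight_rayWeight_left_eq_right hab]
    have hle : ∀ ε ∈ S, k * (ξ ⬝ᵥ toPoint b) ≤ ξ ⬝ᵥ toPoint ε := fun ε hε =>
      (le_dotProduct_of_mul_le hab (hS' ε hε) hξ heq.le).1
    have hbM : k • b ∈ minimizers S ξ := mem_minimizers.mpr ⟨hkb, fun ε hε => by
      rw [dotProduct_toPoint_smul]; exact hle ε hε⟩
    have haM : k • a ∈ minimizers S ξ := mem_minimizers.mpr ⟨hka, fun ε hε => by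
      rw [dotProduct_toPoint_smul, ← heq]; exact hle ε hε⟩
    have hbM₀ := (hM _ hkb).mpr hwab
    have haM₀ := (hM _ hka).mpr rfl
    have hne : k • a ≠ k • b := by
      intro h0
      obtain ⟨r, hr, hr'⟩ := hab.exists_left
      have := DFunLike.congr_fun h0 r
      simp only [Finsupp.smul_apply, smul_eq_mul, hr', mul_zero] at this
      exact (Nat.mul_pos hk hr).ne' this
    have hdot : ∀ {η : Fin n → ℝ}, k • a ∈ minimizers S η → k • b ∈ minimizers S η →
        η ⬝ᵥ (toPoint (k • b) - toPoint (k • a)) = 0 := fun h1 h2 => by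
      rw [dotProduct_sub, sub_eq_zero]
      exact le_antisymm ((mem_minimizers.mp h2).2 _ hka) ((mem_minimizers.mp h1).2 _ hkb)
    have hmins : minimizers S ξ = minimizers S ξ₀ := by
      ext ε
      constructor
      · intro hε
        obtain ⟨c, hc⟩ := exists_smul_eq_of_faceDim_eq_one hξ hE.2.2 haM hbM hne hε
        have h3 := congrArg (ξ₀ ⬝ᵥ ·) hc
        simp only [dotProduct_smul, hdot haM₀ hbM₀, smul_zero] at h3
        rw [dotProduct_sub, sub_eq_zero] at h3
        exact mem_minimizers.mpr ⟨(mem_minimizers.mp hε).1, fun ε' hε' =>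
          h3 ▸ (mem_minimizers.mp haM₀).2 ε' hε'⟩
      · intro hε
        have hεS := (mem_minimizers.mp hε).1
        obtain ⟨c, hc⟩ := toPoint_sub_eq_of_weight_eq hab ((hM ε hεS).mp hε)
        have h3 := congrArg (ξ ⬝ᵥ ·) hc
        simp only [dotProduct_smul, dotProduct_sub, heq, sub_self, smul_zero] at h3
        rw [sub_eq_zero] at h3
        exact mem_minimizers.mpr ⟨hεS, fun ε' hε' => h3 ▸ (mem_minimizers.mp haM).2 ε' hε'⟩
    rw [faceAt_eq_convexHull hξ, faceAt_eq_convexHull hξ₀, hmins]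
  · refine absurd hE.2.2 (le_dotProduct_of_edge hab.symm hka (fun ε hε r s hr hs => ?_) hξ hgt)
    have := hS' ε hε s r hs hr
    rw [mul_comm (b r), add_comm]
    exact this

end Directions

/-! ### Expansions as polynomials, and the completion. -/

section Main

open IsLocalRing MvPolynomial

variable {R : Type*} [CommRing R] {n : ℕ}

/-- The polynomial with the coefficients of an expansion. -/
noncomputable def expansionPolynomial (a : (Fin n →₀ ℕ) →₀ R) : MvPolynomial (Fin n) R :=
  ∑ α ∈ a.support, monomial α (a α)

theorem coeff_expansionPolynomial (a : (Fin n →₀ ℕ) →₀ R) (δ : Fin n →₀ ℕ) :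
    (expansionPolynomial a).coeff δ = a δ := by
  classical
  simp only [expansionPolynomial, coeff_sum, coeff_monomial]
  rw [Finset.sum_ite_eq']
  simp [eq_comm]

theorem IsExpansion.algebraMap_eq {S : Type*} [CommRing S] [Algebra R S] {x : Fin n → R} {f : R}
    {a : (Fin n →₀ ℕ) →₀ R} (h : IsExpansion x f a) :
    algebraMap R S f = aeval (fun i => algebraMap R S (x i)) (expansionPolynomial a) := by
  rw [h.eq_sum, expansionPolynomial, map_sum, map_sum]
  refine Finset.sum_congr rfl fun α _ => ?_
  rw [aeval_monomial, map_mul, map_prod, Finsupp.prod_fintype _ _ fun i => pow_zero _]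
  simp

variable [IsLocalRing R]

open Classical in
theorem coeff_symbolicRestriction (a : (Fin n →₀ ℕ) →₀ R) (A : Set (Fin n → ℝ))
    (δ : Fin n →₀ ℕ) :
    (symbolicRestriction a A).coeff δ = if toPoint δ ∈ A then residue R (a δ) else 0 := by
  simp only [symbolicRestriction, coeff_sum, coeff_monomial]
  rw [Finset.sum_ite_eq']
  by_cases h : a δ = 0
  · simp [h]
  · simp [h]

/-- Evaluation of the completion in the residue field kills the extended ideal but not 1. -/
theorem map_maximalIdeal_adicCompletion_ne_top :
    (maximalIdeal R).map (algebraMap R (AdicCompletion (maximalIdeal R) R)) ≠ ⊤ := by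
  intro h
  have hle : (maximalIdeal R).map (algebraMap R (AdicCompletion (maximalIdeal R) R)) ≤
      RingHom.ker (AdicCompletion.evalOneₐ (maximalIdeal R)) := by
    rw [Ideal.map_le_iff_le_comap]
    intro r hr
    rw [Ideal.mem_comap, RingHom.mem_ker, AlgHom.commutes]
    exact Ideal.Quotient.eq_zero_iff_mem.mpr hr
  rw [h] at hle
  have h1 := hle (Submodule.mem_top : (1 : AdicCompletion (maximalIdeal R) R) ∈ _)
  rw [RingHom.mem_ker, map_one] at h1
  exact one_ne_zero h1

theorem isAdicComplete_adicCompletion (h : (maximalIdeal R).FG) :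
    IsAdicComplete ((maximalIdeal R).map (algebraMap R (AdicCompletion (maximalIdeal R) R)))
      (AdicCompletion (maximalIdeal R) R) :=
  (IsAdicComplete.map_algebraMap_iff _ _).mpr (AdicCompletion.isAdicComplete h)

end Main

end LooseEdge

namespace LooseEdge

/-! ### The symbolic restriction to a loose edge, and the theorem. -/

section Main

open IsLocalRing MvPolynomial

/-- The normal form of the symbolic restriction to a loose edge: up to a monomial, it is a binary
form in `X^a` and `X^b` of positive degree. -/
theorem exists_symbolicRestriction_eq {R : Type*} [CommRing R] [IsLocalRing R] {n : ℕ}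
    {x : Fin n → R} {f : R} {a : (Fin n →₀ ℕ) →₀ R} (ha : IsExpansion x f a)
    {E : Set (Fin n → ℝ)} (hE : IsLooseEdge (newtonPolyhedron a) E) :
    ∃ (ξ : Fin n → ℝ) (p q γ : Fin n →₀ ℕ) (φ : Polynomial (ResidueField R)), (∀ i, 0 < ξ i) ∧
      E = faceAt (polyhedron a.support) ξ ∧ IsPrimitivePair p q ∧
      φ.coeff 0 ≠ 0 ∧ 0 < φ.natDegree ∧
      (∀ ε, a ε ≠ 0 → Finsupp.weight (rayWeight p q) (γ + φ.natDegree • p) ≤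
        Finsupp.weight (rayWeight p q) ε) ∧
      (∀ ε ∈ a.support, ε ∈ minimizers a.support ξ ↔ Finsupp.weight (rayWeight p q) ε =
        Finsupp.weight (rayWeight p q) (γ + φ.natDegree • p)) ∧
      symbolicRestriction a E = monomial γ 1 * binaryForm p q φ.natDegree φ ∧
      ∀ δ, Finsupp.weight (rayWeight p q) δ =
        Finsupp.weight (rayWeight p q) (γ + φ.natDegree • p) →
        residue R (a δ) = (symbolicRestriction a E).coeff δ := by
  classical
  rw [newtonPolyhedron_eq] at hE
  obtain ⟨ξ, p, q, δ₁, δ₂, hξ, rfl, hpq, h₁, h₂, hne, hle, hM⟩ :=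
    IsLooseEdge.exists_isPrimitivePair hE
  set E := faceAt (polyhedron a.support) ξ
  have hmem : ∀ {δ}, a δ ≠ 0 → (toPoint δ ∈ E ↔ Finsupp.weight (rayWeight p q) δ =
      Finsupp.weight (rayWeight p q) δ₁) := fun {δ} hδ =>
    (toPoint_mem_faceAt_iff (fun i => (hξ i).le) (Finsupp.mem_support_iff.mpr hδ)).trans
      (hM δ (Finsupp.mem_support_iff.mpr hδ))
  have hunit : ∀ {δ}, a δ ≠ 0 → residue R (a δ) ≠ 0 := fun {δ} hδ =>
    (residue_ne_zero_iff_isUnit _).mpr ((ha.isUnit_or_eq_zero δ).resolve_right hδ)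
  have hcoeff : ∀ {δ}, δ ∈ minimizers a.support ξ → (symbolicRestriction a E).coeff δ ≠ 0 := by
    intro δ hδ
    have hδS := (mem_minimizers.mp hδ).1
    rw [coeff_symbolicRestriction, if_pos ((toPoint_mem_faceAt_iff (fun i => (hξ i).le) hδS).mpr hδ)]
    exact hunit (Finsupp.mem_support_iff.mp hδS)
  have hhom : IsWeightedHomogeneous (rayWeight p q) (symbolicRestriction a E)
      (Finsupp.weight (rayWeight p q) δ₁) := by
    intro δ hδ
    rw [coeff_symbolicRestriction] at hδ
    split_ifs at hδ with hE
    · refine (hmem fun h0 => hδ ?_).mp hE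
      rw [h0, map_zero]
    · exact absurd rfl hδ
  have hne0 : symbolicRestriction a E ≠ 0 := ne_zero_iff.mpr ⟨δ₁, hcoeff h₁⟩
  obtain ⟨γ, φ, hφ, heq⟩ := exists_eq_monomial_mul_binaryForm hpq hne0 hhom
  have hw : Finsupp.weight (rayWeight p q) δ₁ =
      Finsupp.weight (rayWeight p q) (γ + φ.natDegree • p) := by
    refine IsWeightedHomogeneous.inj_right hne0 hhom ?_
    rw [heq]
    exact isWeightedHomogeneous_monomial_mul_binaryForm hpq γ φ
  refine ⟨ξ, p, q, γ, φ, hξ, rfl, hpq, hφ, Nat.pos_of_ne_zero fun h0 => ?_,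
    fun ε hε => hw ▸ hle ε (Finsupp.mem_support_iff.mpr hε), hw ▸ hM, heq, fun δ hδ => ?_⟩
  -- Degree zero would leave a single monomial, while δ₁ ≠ δ₂ both occur because residues of units
  -- do not vanish.
  · obtain ⟨c, rfl⟩ := Polynomial.natDegree_eq_zero.mp h0
    rw [Polynomial.natDegree_C, binaryForm_C, mul_comm, C_mul_monomial, mul_one] at heq
    have h3 := hcoeff h₁
    have h4 := hcoeff h₂
    rw [heq, coeff_monomial] at h3 h4
    exact hne ((ite_ne_right_iff.mp h3).1.symm.trans (ite_ne_right_iff.mp h4).1)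
  · rw [coeff_symbolicRestriction]
    split_ifs with hδE
    · rfl
    · by_contra hc
      have h0 : a δ ≠ 0 := fun h0 => hc (by rw [h0, map_zero])
      exact hδE ((hmem h0).mpr (hδ.trans hw.symm))

theorem coeff_ne_zero_of_symbolicRestriction {R : Type*} [CommRing R] [IsLocalRing R] {n : ℕ}
    {a : (Fin n →₀ ℕ) →₀ R} {E : Set (Fin n → ℝ)} {δ : Fin n →₀ ℕ}
    (h : (symbolicRestriction a E).coeff δ ≠ 0) : a δ ≠ 0 := by
  classical
  intro h0
  rw [coeff_symbolicRestriction, h0, map_zero, ite_self] at h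
  exact h rfl

/-- A constant multiple of a power of an irreducible polynomial over an algebraically closed field is
the power of a linear polynomial. -/
theorem exists_eq_linear_pow {K : Type*} [Field K] [IsAlgClosed K] {c : K} {ψ : Polynomial K}
    {m : ℕ} (hm : m ≠ 0) (hψ : Irreducible ψ) :
    ∃ u v : K, Polynomial.C c * ψ ^ m = (Polynomial.C u * Polynomial.X + Polynomial.C v) ^ m := by
  obtain ⟨t, rfl⟩ := IsAlgClosed.exists_pow_nat_eq c (Nat.pos_of_ne_zero hm)
  obtain ⟨u, v, huv⟩ := Polynomial.exists_eq_X_add_C_of_natDegree_le_one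
    (Polynomial.natDegree_le_of_degree_le
      (IsAlgClosed.degree_eq_one_of_irreducible K hψ).le)
  refine ⟨t * u, t * v, ?_⟩
  rw [map_pow, ← mul_pow, huv, map_mul, map_mul]
  ring

end Main

end LooseEdge

theorem corollary1p4 {R : Type*} [CommRing R] [IsRegularLocalRing R]
    {n : ℕ} (x : Fin n → R) (hx : LooseEdge.IsRegularSystemOfParameters x)
    (f : R) (a : (Fin n →₀ ℕ) →₀ R) (ha : LooseEdge.IsExpansion x f a)
    (E : Set (Fin n → ℝ))
    (hE : LooseEdge.IsLooseEdge (LooseEdge.newtonPolyhedron a) E)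
    (hf : Irreducible
      (algebraMap R (AdicCompletion (IsLocalRing.maximalIdeal R) R) f)) :
    (∀ E' : Set (Fin n → ℝ),
        LooseEdge.IsCompactEdge (LooseEdge.newtonPolyhedron a) E' → E' = E) ∧
    (∃ (c : (IsLocalRing.ResidueField R)ˣ)
        (F : MvPolynomial (Fin n) (IsLocalRing.ResidueField R)) (k : ℕ),
        Irreducible F ∧
        LooseEdge.symbolicRestriction a E =
          MvPolynomial.C (c : IsLocalRing.ResidueField R) * F ^ k) ∧
    (IsAlgClosed (IsLocalRing.ResidueField R) →
      ∃ (b₁ b₂ : IsLocalRing.ResidueField R) (k : ℕ) (α β : Fin n →₀ ℕ),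
        LooseEdge.IsPrimitiveVector (fun i => (α i : ℤ) - (β i : ℤ)) ∧
        LooseEdge.symbolicRestriction a E =
          (MvPolynomial.monomial α b₁ + MvPolynomial.monomial β b₂) ^ k) := by
  open LooseEdge MvPolynomial in
  have := isAdicComplete_adicCompletion (R := R)
    (hx.span_range_eq ▸ Submodule.fg_span (Set.finite_range x))
  obtain ⟨ξ, p, q, γ, φ, hξ, hEξ, hpq, hφ0, hφ, hle, hM, hres, hfin⟩ :=
    exists_symbolicRestriction_eq ha hE
  rw [ha.algebraMap_eq] at hf
  rw [hres] at hfin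
  obtain ⟨rfl, c, ψ, m, hc, hm, hψ, hφψ⟩ := initialForm_of_irreducible
    map_maximalIdeal_adicCompletion_ne_top hx.span_range_eq hpq hφ0 hφ
    (f := expansionPolynomial a) (fun δ hδ => hle δ (by rwa [coeff_expansionPolynomial] at hδ))
    (fun δ hδ => by rw [coeff_expansionPolynomial, hfin δ hδ]) hf
  rw [zero_add] at hle hM
  rw [monomial_zero', C_1, one_mul] at hres
  refine ⟨fun E' hE' => ?_, ?_, fun hK => ?_⟩
  · rw [newtonPolyhedron_eq] at hE'
    rw [hEξ]
    -- Applied to the leading and the constant coefficient of φ, this puts both ends of the edge,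
    -- the multiples of p and q by deg φ, into the support.
    have hcoeff : ∀ i ≤ φ.natDegree, φ.coeff i ≠ 0 →
        i • p + (φ.natDegree - i) • q ∈ a.support := fun i hi h0 => by
      refine Finsupp.mem_support_iff.mpr (coeff_ne_zero_of_symbolicRestriction (E := E) ?_)
      rwa [hres, coeff_binaryForm hpq hi]
    refine eq_of_isCompactEdge hpq hφ ?_ ?_
      (fun ε hε => hle ε (Finsupp.mem_support_iff.mp hε)) hξ hM hE'
    · have hlead : φ.coeff φ.natDegree ≠ 0 := by
        rw [Polynomial.coeff_natDegree, Polynomial.leadingCoeff_ne_zero]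
        rintro rfl
        simp at hφ
      simpa using hcoeff _ le_rfl hlead
    · simpa using hcoeff 0 (Nat.zero_le _) hφ0
  · have hψ0 : ψ.coeff 0 ≠ 0 := by
      intro h0
      rw [hφψ, Polynomial.mul_coeff_zero, Polynomial.coeff_zero_eq_eval_zero (ψ ^ m),
        Polynomial.eval_pow, ← Polynomial.coeff_zero_eq_eval_zero, h0, zero_pow hm, mul_zero] at hφ0
      exact hφ0 rfl
    refine ⟨Units.mk0 c hc, binaryForm p q ψ.natDegree ψ, m, irreducible_binaryForm hpq hψ hψ0, ?_⟩
    -- The summand 0 is the degree in which the constant c is homogenized.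
    have hdeg : φ.natDegree = 0 + m * ψ.natDegree := by
      rw [hφψ, Polynomial.natDegree_C_mul hc, Polynomial.natDegree_pow, zero_add]
    rw [hres, hdeg, hφψ, binaryForm_mul p q (Polynomial.natDegree_C c).le
      (Polynomial.natDegree_pow_le_of_le m le_rfl), binaryForm_C, binaryForm_pow p q le_rfl,
      Units.val_mk0]
  · obtain ⟨u, v, huv⟩ := exists_eq_linear_pow (c := c) hm hψ
    refine ⟨u, v, m, p, q, hpq.isPrimitiveVector, ?_⟩
    have hdeg : φ.natDegree = m * 1 := by
      rw [hφψ, Polynomial.natDegree_C_mul hc, Polynomial.natDegree_pow,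
        Polynomial.natDegree_eq_of_degree_eq_some (n := 1)
          (IsAlgClosed.degree_eq_one_of_irreducible _ hψ)]
    rw [hres, hdeg, hφψ, huv, binaryForm_pow p q (d := 1) Polynomial.natDegree_linear_le,
      binaryForm_eq_sum]
    congr 1
    rw [Finset.sum_range_succ, Finset.sum_range_one]
    simp [add_comm]
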